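/- Let $q$ be a power of $2$, let $m\ge 1$, let $V=\mathbb{F}_q^{2m}$ with its standard nondegenerate alternating form $(\cdot,\cdot)$, and let $G=\mathrm{Sp}_{2m}(q)$ be the isometry group of this form. Let $Q^+$ and $Q^-$ be quadratic forms on $V$ with $Q^{\pm}(x+y)-Q^{\pm}(x)-Q^{\pm}(y)=(x,y)$ for all $x,y\in V$, of Witt index $m$ and $m-1$ respectively, and for $\varepsilon\in\{+,-\}$ let $\mathrm{O}^{\varepsilon}_{2m}(q)\le G$ be the isometry group of $Q^{\varepsilon}$. Let $\pi$ be the complex permutation character of $G$ on $V$, let $\Omega^{\varepsilon}$ be the $G$-set of cosets of $\mathrm{O}^{\varepsilon}_{2m}(q)$ in $G$, and let $\pi^{\varepsilon}$ be its complex permutation character. Then: (1) The $\mathbb{C}G$-modules $\mathbb{C}V$ and $\mathbb{C}\Omega^+\oplus\mathbb{C}\Omega^-$ are isomorphic; that is, $\pi=\pi^++\pi^-$. (2) Suppose $m\ge 2$. Then the permutation character of $G$ on the set of $1$-dimensional subspaces of $V$ equals $1+\chi^++\chi^-$ for distinct nontrivial irreducible characters $\chi^+,\chi^-$ of $G$ with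 $\chi^-(1)<\chi^+(1)$, and the following holds for every $v\in V\setminus\{0\}$. Let $G_v$ be the stabilizer of $v$ and $P$ the stabilizer of $\langle v\rangle$ in $G$, and let $\mathcal{S}$ be any set of representatives, up to complex conjugation, of the nontrivial linear characters of $P$ with $G_v$ in their kernel (such sets exist). Then $|\mathcal{S}|=q/2-1$, the induced characters $\zeta_P^G$ $(\zeta\in\mathcal{S})$ are irreducible and pairwise distinct, and with $\pi'=\sum_{\zeta\in\mathcal{S}}\zeta_P^G$ we have $$\pi^+=1+\chi^++\pi',\qquad \pi^-=1+\chi^-+\pi'.$$ -/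

import Mathlib

open scoped LinearAlgebra.Projectivization

noncomputable section

namespace SpOrthogonal

/-- The symplectic group `Sp_{2m}(F)` of `2m × 2m` matrices preserving the standard form. -/
abbrev Sp (m : ℕ) (F : Type*) [Field F] : Type _ := ↥(Matrix.symplecticGroup (Fin m) F)

/-- The natural module `F^{2m}` (column vectors), on which `Sp m F` acts by `g • v = g *ᵥ v`. -/
abbrev V (m : ℕ) (F : Type*) : Type _ := Fin m ⊕ Fin m → F

/-- The standard symplectic form on the natural module, with Gram matrix `Matrix.J`. -/
def sympForm {m : ℕ} {F : Type*} [Field F] (x y : V m F) : F :=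
  x ⬝ᵥ Matrix.mulVec (Matrix.J (Fin m) F) y

/-- The quadratic form `Q` has the standard symplectic form as its associated bilinear form:
`Q (x + y) - Q x - Q y = (x, y)`. -/
def PolarizesToSymp {m : ℕ} {F : Type*} [Field F] (Q : QuadraticForm F (V m F)) : Prop :=
  ∀ x y : V m F, QuadraticMap.polar Q x y = sympForm x y

/-- The subspace `W` is totally singular for `Q`. -/
def IsTotallySingular {m : ℕ} {F : Type*} [Field F] (Q : QuadraticForm F (V m F))
    (W : Submodule F (V m F)) : Prop :=
  ∀ w ∈ W, Q w = 0

/-- `Q` is a quadratic form of plus type on the symplectic space `V`: it polarizes to the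
symplectic form and has Witt index `m`. -/
structure IsPlusType {m : ℕ} {F : Type*} [Field F] (Q : QuadraticForm F (V m F)) : Prop where
  polar_eq : PolarizesToSymp Q
  exists_singular : ∃ W, IsTotallySingular Q W ∧ Module.finrank F W = m
  finrank_le : ∀ W, IsTotallySingular Q W → Module.finrank F W ≤ m

/-- `Q` is a quadratic form of minus type on the symplectic space `V`: it polarizes to the
symplectic form and has Witt index `m - 1`. -/
structure IsMinusType {m : ℕ} {F : Type*} [Field F] (Q : QuadraticForm F (V m F)) : Prop where
  polar_eq : PolarizesToSymp Q
  exists_singular : ∃ W, IsTotallySingular Q W ∧ Module.finrank F W + 1 = m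
  finrank_lt : ∀ W, IsTotallySingular Q W → Module.finrank F W < m

/-- The orthogonal group of `Q` as a subgroup of `Sp_{2m}(F)`. For `Q` polarizing to the symplectic
form this is the full isometry group of `Q`, since isometries of `Q` preserve its polar form. -/
def orthogonalSubgroup {m : ℕ} {F : Type*} [Field F] (Q : QuadraticForm F (V m F)) :
    Subgroup (Sp m F) where
  carrier := {g | ∀ v : V m F, Q (g • v) = Q v}
  one_mem' := by intro v; rw [one_smul]
  mul_mem' := by
    intro a b ha hb v
    rw [mul_smul, ha, hb]
  inv_mem' := by
    intro a ha v
    rw [← ha (a⁻¹ • v), smul_inv_smul]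

/-- The complex permutation module `ℂX` of a `G`-set `X`. -/
abbrev permModule (G X : Type*) [Group G] [MulAction G X] :=
  Representation.ofMulAction ℂ G X

/-- The complex permutation character of a `G`-set `X`. -/
abbrev permChar (G X : Type*) [Group G] [MulAction G X] : G → ℂ :=
  (permModule G X).character

/-- `χ` is the character of an irreducible finite-dimensional complex representation of `G`. -/
def IsIrreducibleCharacter {G : Type*} [Group G] (χ : G → ℂ) : Prop :=
  ∃ (n : ℕ) (ρ : Representation ℂ G (Fin n → ℂ)), ρ.IsIrreducible ∧ ρ.character = χ

/-- The one-dimensional complex representation with character `ζ`. -/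
def linearRep {P : Type*} [Group P] (ζ : P →* ℂˣ) : Representation ℂ P ℂ :=
  (Algebra.lmul ℂ ℂ).toMonoidHom.comp ((Units.coeHom ℂ).comp ζ)

/-- The representation of `G` induced from the linear character `ζ` of the subgroup `P`. -/
abbrev inducedRep {G : Type*} [Group G] {P : Subgroup G} (ζ : P →* ℂˣ) :=
  Representation.ind P.subtype (linearRep ζ)

/-- The complex conjugate of a linear character. -/
def conjChar {P : Type*} [Group P] (ζ : P →* ℂˣ) : P →* ℂˣ :=
  (Units.map (starRingEnd ℂ).toMonoidHom).comp ζ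

/-- The parabolic subgroup `P`: the stabilizer in `Sp_{2m}(F)` of the `1`-subspace `⟨v⟩`. -/
abbrev parabolic {m : ℕ} {F : Type*} [Field F] (v : V m F) (hv : v ≠ 0) : Subgroup (Sp m F) :=
  MulAction.stabilizer (Sp m F) (Projectivization.mk F v hv)

/-- `ζ` is a nontrivial linear character of `P` with the vector stabilizer `G_v` in its kernel, that
is, a nontrivial member of `Irr(P / G_v)`. -/
def IsNontrivialModStabilizer {m : ℕ} {F : Type*} [Field F] {v : V m F} {hv : v ≠ 0}
    (ζ : parabolic v hv →* ℂˣ) : Prop :=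
  ζ ≠ 1 ∧ ∀ g : parabolic v hv, (g : Sp m F) • v = v → ζ g = 1

/-- `S` is a set of representatives, up to complex conjugation, of the nontrivial characters
in `Irr(P / G_v)`. -/
def IsConjRepresentatives {m : ℕ} {F : Type*} [Field F] {v : V m F} {hv : v ≠ 0}
    (S : Finset (parabolic v hv →* ℂˣ)) : Prop :=
  (∀ ζ ∈ S, IsNontrivialModStabilizer ζ) ∧
    ∀ ζ : parabolic v hv →* ℂˣ, IsNontrivialModStabilizer ζ →
      ∃! ξ, ξ ∈ S ∧ (ξ = ζ ∨ ξ = conjChar ζ)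

end SpOrthogonal

end

/-!
`ℂV` is isomorphic to the permutation module on the set of all quadratic forms polarizing to the
symplectic form, by `Q ↦ ∑ x, ψ (Q x) • x` for a nontrivial additive character `ψ` of `F`, and these
forms fall into exactly two orbits, with stabilizers `O⁺` and `O⁻`; this gives `π = π⁺ + π⁻`.

For a character `η` of `Fˣ` let `θ_η` be the character of `Sp` induced from the stabilizer of `⟨v⟩`
by `η` of the eigenvalue on `v`. Then `π = 1 + ∑ η, θ_η`, and `θ_1` is the permutation character on
the points of the projective space. Counting orbits on pairs of nonzero vectors, twisted by `η` and
`ξ`, yields `⟨θ_η, θ_ξ⟩ = [η = ξ] + [η = ξ = 1] + [η ξ = 1]`. So `θ_1 = 1 + χ⁺ + χ⁻`, while for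
`η ≠ 1` the character `θ_η = θ_{η⁻¹}` is irreducible, as `Fˣ` has odd order.

Hence `π = 2 (1 + ∑ η, θ_η) + χ⁺ + χ⁻`, with `η` running over a transversal up to inversion. Each of
`π⁺` and `π⁻` contains `1` exactly once, every `θ_η` with `η ≠ 1`, and a nontrivial constituent of
`θ_1`, because `O^±` is not transitive on the points; this leaves only one way to split `π`. The
inequality of degrees is `|Ω⁻| < |Ω⁺|`.
-/

noncomputable section

namespace SpOrthogonal

section CharacterTheory

open Representation

variable {G : Type*} [Group G] {V W : Type*} [AddCommGroup V] [Module ℂ V] [AddCommGroup W]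
  [Module ℂ W]

lemma isIrreducible_of_equiv {ρ : Representation ℂ G V} {σ : Representation ℂ G W}
    (e : ρ.Equiv σ) (h : ρ.IsIrreducible) : σ.IsIrreducible := by
  rw [irreducible_iff_isSimpleModule_asModule] at h ⊢
  exact (LinearEquiv.ofBijective (IntertwiningMap.equivLinearMapAsModule σ ρ
    e.symm.toIntertwiningMap) e.symm.toLinearEquiv.bijective).isSimpleModule_iff.2 h

lemma isIrreducibleCharacter_of_isIrreducible [FiniteDimensional ℂ V] {ρ : Representation ℂ G V}
    (h : ρ.IsIrreducible) : IsIrreducibleCharacter ρ.character := by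
  let e : V ≃ₗ[ℂ] (Fin (Module.finrank ℂ V) → ℂ) := LinearEquiv.ofFinrankEq _ _ (by simp)
  let σ : Representation ℂ G (Fin (Module.finrank ℂ V) → ℂ) :=
    (e.conjRingEquiv : Module.End ℂ V →* _).comp ρ
  let φ : ρ.Equiv σ := .mk e fun g ↦ by ext; simp [σ, LinearEquiv.conjRingEquiv]
  exact ⟨_, σ, isIrreducible_of_equiv φ h, (char_iso φ).symm⟩

lemma character_eq_zero_of_subsingleton [Subsingleton V] (ρ : Representation ℂ G V) :
    ρ.character = 0 := by
  ext g
  simp [character, Subsingleton.elim (ρ g) 0]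

lemma character_prod [FiniteDimensional ℂ V] [FiniteDimensional ℂ W] (ρ : Representation ℂ G V)
    (σ : Representation ℂ G W) : (ρ.prod σ).character = ρ.character + σ.character :=
  funext fun g ↦ LinearMap.trace_prodMap' (ρ g) (σ g)

lemma character_eq_add_of_isCompl [FiniteDimensional ℂ V] {ρ : Representation ℂ G V}
    {A B : Subrepresentation ρ} (h : IsCompl A.toSubmodule B.toSubmodule) :
    ρ.character = A.toRepresentation.character + B.toRepresentation.character := by
  let e : (A.toRepresentation.prod B.toRepresentation).Equiv ρ :=
    .mk (Submodule.prodEquivOfIsCompl _ _ h) fun g ↦ by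
      ext x <;> simp [Subrepresentation.toRepresentation]
  rw [← char_iso e, character_prod]

lemma exists_isCompl_of_not_isIrreducible [Finite G] [Nontrivial V] {ρ : Representation ℂ G V}
    (h : ¬ρ.IsIrreducible) : ∃ A B : Subrepresentation ρ,
      IsCompl A.toSubmodule B.toSubmodule ∧ A.toSubmodule ≠ ⊤ ∧ B.toSubmodule ≠ ⊤ := by
  have : NeZero (Nat.card G : ℂ) := ⟨Nat.cast_ne_zero.2 Nat.card_pos.ne'⟩
  have : Nontrivial (Subrepresentation ρ) :=
    ⟨⊥, ⊤, fun h ↦ bot_ne_top (α := Submodule ℂ V) (congrArg Subrepresentation.toSubmodule h)⟩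
  obtain ⟨A, hA_bot, hA_top⟩ : ∃ A : Subrepresentation ρ, A ≠ ⊥ ∧ A ≠ ⊤ := by
    by_contra! hall
    exact h ⟨fun A ↦ or_iff_not_imp_left.2 (hall A)⟩
  obtain ⟨B, hAB⟩ := exists_isCompl A
  have hc : IsCompl A.toSubmodule B.toSubmodule :=
    .of_eq (congrArg Subrepresentation.toSubmodule hAB.inf_eq_bot)
      (congrArg Subrepresentation.toSubmodule hAB.sup_eq_top)
  refine ⟨A, B, hc, fun hA ↦ hA_top (Subrepresentation.toSubmodule_injective hA), fun hB ↦
    hA_bot (Subrepresentation.toSubmodule_injective ?_)⟩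
  change A.toSubmodule = ⊥
  simpa [hB] using hc.inf_eq_bot

/-- The multiset `M` consists of irreducible characters with sum `φ`, so it is the multiset of
irreducible constituents of `φ`, with multiplicities. -/
structure IsConstituents (M : Multiset (G → ℂ)) (φ : G → ℂ) : Prop where
  isIrreducibleCharacter : ∀ χ ∈ M, IsIrreducibleCharacter χ
  sum_eq : M.sum = φ

lemma IsIrreducibleCharacter.isConstituents {χ : G → ℂ} (h : IsIrreducibleCharacter χ) :
    IsConstituents {χ} χ :=
  ⟨by simpa using h, Multiset.sum_singleton χ⟩

lemma IsConstituents.add {M N : Multiset (G → ℂ)} {φ ψ : G → ℂ} (hM : IsConstituents M φ)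
    (hN : IsConstituents N ψ) : IsConstituents (M + N) (φ + ψ) where
  isIrreducibleCharacter χ hχ := (Multiset.mem_add.1 hχ).elim
    (hM.isIrreducibleCharacter χ) (hN.isIrreducibleCharacter χ)
  sum_eq := by rw [Multiset.sum_add, hM.sum_eq, hN.sum_eq]

theorem exists_isConstituents [Finite G] [FiniteDimensional ℂ V] (ρ : Representation ℂ G V) :
    ∃ M, IsConstituents M ρ.character := by
  induction hn : Module.finrank ℂ V using Nat.strong_induction_on generalizing V with
  | _ n ih =>
    subst hn
    rcases subsingleton_or_nontrivial V with _ | _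
    · exact ⟨0, by simp, by rw [character_eq_zero_of_subsingleton, Multiset.sum_zero]⟩
    by_cases hρ : ρ.IsIrreducible
    · exact ⟨_, (isIrreducibleCharacter_of_isIrreducible hρ).isConstituents⟩
    obtain ⟨A, B, hAB, hA, hB⟩ := exists_isCompl_of_not_isIrreducible hρ
    obtain ⟨M, hM⟩ := ih _ (Submodule.finrank_lt hA) A.toRepresentation rfl
    obtain ⟨N, hN⟩ := ih _ (Submodule.finrank_lt hB) B.toRepresentation rfl
    exact ⟨M + N, character_eq_add_of_isCompl hAB ▸ hM.add hN⟩

variable [Fintype G]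

/-- The symmetric bilinear form `|G|⁻¹ ∑ a(g) b(g⁻¹)` on complex functions on `G`. On characters it
agrees with the Hermitian inner product, because `χ(g⁻¹)` is the conjugate of `χ(g)`. -/
def charInner (a b : G → ℂ) : ℂ := (Nat.card G : ℂ)⁻¹ * ∑ g, a g * b g⁻¹

lemma charInner_zero_left (a : G → ℂ) : charInner 0 a = 0 := by simp [charInner]

lemma charInner_zero_right (a : G → ℂ) : charInner a 0 = 0 := by simp [charInner]

lemma charInner_add_left (a b c : G → ℂ) :
    charInner (a + b) c = charInner a c + charInner b c := by
  simp [charInner, add_mul, Finset.sum_add_distrib, mul_add]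

lemma charInner_add_right (a b c : G → ℂ) :
    charInner a (b + c) = charInner a b + charInner a c := by
  simp [charInner, mul_add, Finset.sum_add_distrib]

lemma charInner_character [FiniteDimensional ℂ V] [FiniteDimensional ℂ W]
    (ρ : Representation ℂ G V) (σ : Representation ℂ G W) :
    charInner σ.character ρ.character = Module.finrank ℂ (IntertwiningMap ρ σ) := by
  have : Invertible (Nat.card G : ℂ) :=
    invertibleOfNonzero (Nat.cast_ne_zero.2 Nat.card_pos.ne')
  exact card_inv_mul_sum_char_mul_char_eq_finrank ρ σ

lemma charInner_irreducible [DecidableEq (G → ℂ)] {a b : G → ℂ}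
    (ha : IsIrreducibleCharacter a) (hb : IsIrreducibleCharacter b) :
    charInner a b = if a = b then 1 else 0 := by
  obtain ⟨n, ρ, hρ, rfl⟩ := ha
  obtain ⟨k, σ, hσ, rfl⟩ := hb
  rw [charInner_character]
  split_ifs with h
  · rw [← charInner_character, ← h, charInner_character,
      IsIrreducible.finrank_intertwiningMap_self, Nat.cast_one]
  · have : IsEmpty (σ.Equiv ρ) := ⟨fun e ↦ h (char_iso e).symm⟩
    rw [Module.finrank_zero_of_subsingleton, Nat.cast_zero]

omit [Fintype G] in
lemma isIrreducible_of_isIrreducibleCharacter [Finite G] [FiniteDimensional ℂ V]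
    {ρ : Representation ℂ G V} (h : IsIrreducibleCharacter ρ.character) : ρ.IsIrreducible := by
  have := Fintype.ofFinite G
  obtain ⟨n, σ, hσ, hσρ⟩ := h
  have hfin : (Module.finrank ℂ (IntertwiningMap σ ρ) : ℂ) = 1 := by
    rw [← charInner_character, ← hσρ, charInner_character,
      IsIrreducible.finrank_intertwiningMap_self, Nat.cast_one]
  obtain ⟨f, hf⟩ : ∃ f : IntertwiningMap σ ρ, f ≠ 0 := by
    have : Nontrivial (IntertwiningMap σ ρ) :=
      Module.nontrivial_of_finrank_pos (R := ℂ) (by rw [Nat.cast_eq_one.1 hfin]; exact one_pos)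
    exact exists_ne 0
  have hdim : Module.finrank ℂ (Fin n → ℂ) = Module.finrank ℂ V := by
    have := congrFun hσρ 1
    rw [char_one, char_one] at this
    exact_mod_cast this
  have hinj := (IsIrreducible.injective_or_eq_zero f).resolve_right hf
  have hsurj := (LinearMap.injective_iff_surjective_of_finrank_eq_finrank hdim).1 hinj
  exact isIrreducible_of_equiv (f.ofBijective ⟨hinj, hsurj⟩) hσ

namespace IsConstituents

variable {M N : Multiset (G → ℂ)} {φ χ : G → ℂ}

lemma charInner_eq_count [DecidableEq (G → ℂ)] (hM : IsConstituents M φ)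
    (hχ : IsIrreducibleCharacter χ) : charInner φ χ = M.count χ := by
  obtain ⟨hM, rfl⟩ := hM
  induction M using Multiset.induction_on with
  | empty => simp [charInner_zero_left]
  | cons a M ih =>
    rw [Multiset.forall_mem_cons] at hM
    rw [Multiset.sum_cons, charInner_add_left, ih hM.2, charInner_irreducible hM.1 hχ,
      Multiset.count_cons]
    simp only [eq_comm, Nat.cast_add, Nat.cast_ite, Nat.cast_one, Nat.cast_zero, add_comm]

lemma mem_of_charInner_ne_zero (hM : IsConstituents M φ) (hχ : IsIrreducibleCharacter χ)
    (h : charInner φ χ ≠ 0) : χ ∈ M := by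
  classical
  rw [hM.charInner_eq_count hχ, Nat.cast_ne_zero] at h
  exact Multiset.count_ne_zero.1 h

omit [Fintype G] in
lemma unique [Finite G] (hM : IsConstituents M φ) (hN : IsConstituents N φ) : M = N := by
  classical
  have := Fintype.ofFinite G
  ext χ
  by_cases hχ : IsIrreducibleCharacter χ
  · have := hM.charInner_eq_count hχ
    rw [hN.charInner_eq_count hχ] at this
    exact_mod_cast this.symm
  · rw [Multiset.count_eq_zero_of_notMem fun h ↦ hχ (hM.isIrreducibleCharacter χ h),
      Multiset.count_eq_zero_of_notMem fun h ↦ hχ (hN.isIrreducibleCharacter χ h)]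

lemma charInner_eq_sum_count [DecidableEq (G → ℂ)] {ψ : G → ℂ} (hM : IsConstituents M φ)
    (hN : IsConstituents N ψ) : charInner φ ψ = ((N.map M.count).sum : ℕ) := by
  obtain ⟨hN, rfl⟩ := hN
  induction N using Multiset.induction_on with
  | empty => simp [charInner_zero_right]
  | cons a N ih =>
    rw [Multiset.forall_mem_cons] at hN
    rw [Multiset.sum_cons, charInner_add_right, ih hN.2, hM.charInner_eq_count hN.1,
      Multiset.map_cons, Multiset.sum_cons, Nat.cast_add]

end IsConstituents

lemma nodup_of_sum_count_lt_four {α : Type*} [DecidableEq α] {M : Multiset α}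
    (h : (M.map M.count).sum < 4) : M.Nodup := by
  refine Multiset.nodup_iff_count_le_one.2 fun a ↦ ?_
  by_contra! ha
  obtain ⟨N, hN⟩ := Multiset.le_iff_exists_add.1 (Multiset.le_count_iff_replicate_le.1 ha)
  have hle : 2 * M.count a ≤ (M.map M.count).sum := by
    conv_rhs => rw [hN, Multiset.map_add, Multiset.sum_add, ← hN]
    rw [Multiset.map_replicate, Multiset.sum_replicate, smul_eq_mul]
    exact Nat.le_add_right _ _
  omega

lemma sum_count_of_nodup {α : Type*} [DecidableEq α] {M : Multiset α} (h : M.Nodup) :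
    (M.map M.count).sum = M.card := by
  rw [Multiset.map_congr rfl fun a ha ↦ Multiset.count_eq_one_of_mem h ha]
  simp

/-- A repeated constituent would contribute at least `2 ^ 2` to the norm. -/
lemma IsConstituents.nodup_and_card_eq {M : Multiset (G → ℂ)} {φ : G → ℂ}
    (hM : IsConstituents M φ) {n : ℕ} (hn : n < 4) (h : charInner φ φ = n) :
    M.Nodup ∧ M.card = n := by
  classical
  rw [hM.charInner_eq_sum_count hM, Nat.cast_inj] at h
  have hM' := nodup_of_sum_count_lt_four (h.trans_lt hn)
  exact ⟨hM', (sum_count_of_nodup hM').symm.trans h⟩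

lemma isIrreducible_of_charInner_eq_one [FiniteDimensional ℂ V] {ρ : Representation ℂ G V}
    (h : charInner ρ.character ρ.character = 1) : ρ.IsIrreducible := by
  obtain ⟨M, hM⟩ := exists_isConstituents ρ
  obtain ⟨χ, rfl⟩ := Multiset.card_eq_one.1
    (hM.nodup_and_card_eq (n := 1) (by norm_num) (by rw [h, Nat.cast_one])).2
  apply isIrreducible_of_isIrreducibleCharacter
  rw [← hM.sum_eq, Multiset.sum_singleton]
  exact hM.isIrreducibleCharacter χ (Multiset.mem_singleton_self χ)

end CharacterTheory

section Burnside

open MulAction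

variable {G X : Type*} [Group G] [MulAction G X]

lemma card_filter_smul_eq [Fintype G] [DecidableEq X] {x y : X} (h : y ∈ orbit G x) :
    Finset.card {g : G | g • x = y} = Nat.card (stabilizer G x) := by
  obtain ⟨k, rfl⟩ := h
  rw [Nat.card_eq_fintype_card, Fintype.card_subtype]
  exact Finset.card_equiv (Equiv.mulLeft k⁻¹) fun g ↦ by simp [mul_smul, inv_smul_eq_iff]

lemma card_filter_comp_smul [Fintype G] [Fintype X] [IsPretransitive G X] (x : X) (p : X → Prop)
    [DecidablePred p] :
    Finset.card {g : G | p (g • x)} = Nat.card (stabilizer G x) * Finset.card {y | p y} := by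
  classical
  rw [Finset.card_eq_sum_card_fiberwise (f := (· • x)) (t := {y | p y}) fun g ↦ by simp,
    Finset.sum_congr rfl fun y hy ↦ ?_, Finset.sum_const, smul_eq_mul, mul_comm]
  rw [← card_filter_smul_eq (exists_smul_eq G x y), Finset.filter_filter]
  congr 1
  refine Finset.filter_congr fun g _ ↦ and_iff_right_of_imp ?_
  rintro rfl
  exact (Finset.mem_filter.1 hy).2

lemma sum_card_stabilizer_orbit {s : Finset X} {x : X}
    (hs : ∀ y, y ∈ s ↔ y ∈ orbit G x) : ∑ y ∈ s, Nat.card (stabilizer G y) = Nat.card G := by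
  have hcard {y : X} (hy : y ∈ s) : s.card * Nat.card (stabilizer G y) = Nat.card G := by
    have : s.card = Nat.card (orbit G y) := by
      rw [orbit_eq_iff.2 ((hs y).1 hy), ← Nat.card_congr (Equiv.subtypeEquivRight hs),
        Nat.card_eq_fintype_card, Fintype.card_coe]
    rw [this, ← Nat.card_prod, Nat.card_congr (orbitProdStabilizerEquivGroup G y)]
  have hpos : 0 < s.card := Finset.card_pos.2 ⟨x, (hs x).2 (mem_orbit_self x)⟩
  refine Nat.eq_of_mul_eq_mul_left hpos ?_
  rw [Finset.mul_sum, Finset.sum_congr rfl fun y hy ↦ hcard hy, Finset.sum_const, smul_eq_mul]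

/-- Taking for `σ` and `τ` the identity gives Burnside's lemma. -/
theorem sum_card_smul_eq_twist {I : Type*} [Fintype G] [Fintype X] [Fintype I] [DecidableEq X]
    [DecidableEq I] {f : X → I} (hf : Function.Surjective f)
    (hfib : ∀ x y, f x = f y ↔ y ∈ orbit G x) {σ : X → X} {τ : I → I}
    (hστ : ∀ x, f (σ x) = τ (f x)) :
    ∑ g : G, Finset.card {x | g • x = σ x} = Nat.card G * Finset.card {i | τ i = i} := by
  have hcount (x : X) : Finset.card {g : G | g • x = σ x} =
      if τ (f x) = f x then Nat.card (stabilizer G x) else 0 := by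
    split_ifs with hx
    · exact card_filter_smul_eq ((hfib _ _).1 (by rw [hστ, hx]))
    · refine Finset.card_eq_zero.2 (Finset.filter_eq_empty_iff.2 fun g _ hg ↦ hx ?_)
      rw [← hστ, (hfib x (σ x)).2 ⟨g, hg⟩]
  have hfibre (i : I) : ∑ x with f x = i, (if τ (f x) = f x then Nat.card (stabilizer G x) else 0) =
      if τ i = i then Nat.card G else 0 := by
    obtain ⟨x, rfl⟩ := hf i
    rw [Finset.sum_congr rfl fun y hy ↦ by rw [(Finset.mem_filter.1 hy).2]]
    split_ifs
    · exact sum_card_stabilizer_orbit (x := x) (by simp [← hfib, eq_comm])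
    · exact Finset.sum_const_zero
  calc ∑ g : G, Finset.card {x | g • x = σ x}
      = ∑ x, Finset.card {g : G | g • x = σ x} := by
        simp only [Finset.card_filter]
        exact Finset.sum_comm
    _ = ∑ i, if τ i = i then Nat.card G else 0 := by
        simp only [hcount, ← hfibre, Finset.sum_fiberwise]
    _ = Nat.card G * Finset.card {i | τ i = i} := by
        rw [Finset.sum_ite, Finset.sum_const_zero, add_zero, Finset.sum_const, smul_eq_mul,
          mul_comm]

end Burnside

section PermutationModules

open Representation MonoidAlgebra

variable {G : Type*} [Group G]

instance finiteDimensional_monoidAlgebra {X : Type*} [Finite X] :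
    FiniteDimensional ℂ (MonoidAlgebra ℂ X) :=
  .of_basis (basis X ℂ)

lemma finrank_monoidAlgebra (X : Type*) :
    Module.finrank ℂ (MonoidAlgebra ℂ X) = Nat.card X :=
  Module.finrank_eq_nat_card_basis (basis X ℂ)

lemma trace_monoidAlgebra {X : Type*} [Fintype X] (f : Module.End ℂ (MonoidAlgebra ℂ X)) :
    LinearMap.trace ℂ _ f = ∑ x, (f (single x 1)).coeff x := by
  classical
  rw [LinearMap.trace_eq_matrix_trace ℂ (basis X ℂ), Matrix.trace]
  refine Finset.sum_congr rfl fun x _ ↦ ?_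
  rw [Matrix.diag_apply, LinearMap.toMatrix_apply, basis_apply]
  rfl

variable {X Y Z : Type*} [MulAction G X] [MulAction G Y] [MulAction G Z]

lemma permChar_apply [Fintype X] [DecidableEq X] (g : G) :
    permChar G X g = Finset.card {x : X | g • x = x} := by
  rw [permChar, character, trace_monoidAlgebra, Finset.card_filter, Nat.cast_sum]
  simp [Finsupp.single_apply]

lemma permChar_one_re [Finite X] : (permChar G X 1).re = Nat.card X := by
  rw [permChar, char_one, finrank_monoidAlgebra, Complex.natCast_re]

lemma permChar_inv [Finite X] (g : G) : permChar G X g⁻¹ = permChar G X g := by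
  classical
  have := Fintype.ofFinite X
  simp only [permChar_apply, inv_smul_eq_iff, @eq_comm X (g • _)]

lemma permChar_prod [Finite X] [Finite Y] :
    permChar G (X × Y) = permChar G X * permChar G Y := by
  classical
  have := Fintype.ofFinite X
  have := Fintype.ofFinite Y
  ext g
  rw [Pi.mul_apply, permChar_apply, permChar_apply, permChar_apply, ← Nat.cast_mul,
    ← Finset.card_product, ← Finset.filter_product]
  simp [Prod.ext_iff]

lemma charInner_permChar_one [Fintype G] [Finite X] :
    charInner (permChar G X) 1 = Nat.card (MulAction.orbitRel.Quotient G X) := by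
  classical
  have := Fintype.ofFinite X
  have key := MulAction.sum_card_fixedBy_eq_card_orbits_mul_card_group G X
  rw [charInner, inv_mul_eq_iff_eq_mul₀ (Nat.cast_ne_zero.2 Nat.card_pos.ne'), mul_comm,
    Nat.card_eq_fintype_card, Nat.card_eq_fintype_card, ← Nat.cast_mul, ← key, Nat.cast_sum]
  refine Finset.sum_congr rfl fun g _ ↦ ?_
  rw [Pi.one_apply, mul_one, permChar_apply, ← Fintype.card_subtype]
  rfl

lemma charInner_permChar [Fintype G] [Finite X] [Finite Y] :
    charInner (permChar G X) (permChar G Y) =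
      Nat.card (MulAction.orbitRel.Quotient G (X × Y)) := by
  rw [← charInner_permChar_one, permChar_prod]
  simp only [charInner, permChar_inv, Pi.mul_apply, Pi.one_apply, mul_one]

/-- The permutation module of a disjoint union of two invariant parts. -/
def permModuleProd (e : X ⊕ Y ≃ Z) (hl : ∀ (g : G) x, e (.inl (g • x)) = g • e (.inl x))
    (hr : ∀ (g : G) y, e (.inr (g • y)) = g • e (.inr y)) :
    (permModule G Z).Equiv ((permModule G X).prod (permModule G Y)) :=
  .symm <| .mk (((coeffLinearEquiv ℂ).prodCongr (coeffLinearEquiv ℂ)).trans <|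
    (Finsupp.sumFinsuppLEquivProdFinsupp ℂ).symm.trans <|
      (Finsupp.domLCongr e).trans (coeffLinearEquiv ℂ).symm) fun g ↦ by
    refine LinearMap.prod_ext ?_ ?_ <;> ext x
    · simp [hl]
    · simp [hr]

end PermutationModules

section InducedRepresentations

open Representation

variable {G : Type*} [Group G] {P : Subgroup G} (ζ : P →* ℂˣ)

/-- The generator `h ⊗ 1` of the induced module. With Mathlib's conventions the group acts by
`g • (h ⊗ 1) = h g⁻¹ ⊗ 1`. -/
def indMk (h : G) : IndV P.subtype (linearRep ζ) := IndV.mk P.subtype (linearRep ζ) h 1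

lemma indMk_mul (p : P) (h : G) : indMk ζ (p * h) = (ζ p : ℂ)⁻¹ • indMk ζ h := by
  have := Coinvariants.mk_self_apply (Representation.tprod ((leftRegular ℂ G).comp P.subtype)
    (linearRep ζ)) p (TensorProduct.tmul ℂ (MonoidAlgebra.single h 1) 1)
  rw [eq_inv_smul_iff₀ (ζ p).ne_zero]
  refine Eq.trans ?_ this
  rw [indMk, ← map_smul]
  simp only [linearRep, AlgHom.toRingHom_eq_coe, RingHom.toMonoidHom_eq_coe,
    AlgHom.toRingHom_toMonoidHom, smul_eq_mul, mul_one, Representation.tprod_apply,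
    MonoidHom.coe_comp, Subgroup.coe_subtype, Function.comp_apply, MonoidHom.coe_coe,
    Algebra.coe_lmul_eq_mul, Units.coeHom_apply, TensorProduct.map_tmul, ofMulAction_single,
    LinearMap.mul_apply_apply]
  rfl

instance [Finite G] : FiniteDimensional ℂ (IndV P.subtype (linearRep ζ)) :=
  have : FiniteDimensional ℂ (TensorProduct ℂ (MonoidAlgebra ℂ G) ℂ) := inferInstance
  Module.Finite.quotient _ _

lemma inducedRep_indMk (g h : G) : inducedRep ζ g (indMk ζ h) = indMk ζ (h * g⁻¹) :=
  ind_mk ..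

variable {ζ} {W : Type*} [AddCommGroup W] [Module ℂ W]

lemma ind_linearMap_ext {f f' : IndV P.subtype (linearRep ζ) →ₗ[ℂ] W}
    (h : ∀ g, f (indMk ζ g) = f' (indMk ζ g)) : f = f' :=
  IndV.hom_ext _ _ fun g ↦ LinearMap.ext_ring (h g)

variable {ρ : Representation ℂ G W} {y : W}

/-- Frobenius reciprocity: a `ζ`-semi-invariant vector gives a map from the induced module. -/
def indLift (hy : ∀ p : P, ρ p y = (ζ p : ℂ) • y) : IntertwiningMap (inducedRep ζ) ρ where
  toLinearMap := Coinvariants.lift _ (TensorProduct.lift <|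
    (Finsupp.lift _ _ _ fun h ↦ LinearMap.toSpanSingleton ℂ W (ρ h⁻¹ y)) ∘ₗ
      (MonoidAlgebra.coeffLinearEquiv ℂ).toLinearMap) fun p ↦ by
    ext h
    have hp : ρ (p : G)⁻¹ y = (ζ p : ℂ)⁻¹ • y := by
      rw [eq_inv_smul_iff₀ (ζ p).ne_zero, ← map_smul, ← hy, inv_self_apply]
    simp [linearRep, hp]
  isIntertwining' g := by
    refine ind_linearMap_ext fun h ↦ ?_
    simp [indMk]

lemma indLift_indMk (hy : ∀ p : P, ρ p y = (ζ p : ℂ) • y) (h : G) :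
    indLift hy (indMk ζ h) = ρ h⁻¹ y := by
  simp [indLift, indMk]

lemma charInner_inducedRep_ne_zero [Fintype G] [FiniteDimensional ℂ W]
    (hy : ∀ p : P, ρ p y = (ζ p : ℂ) • y) (hy0 : y ≠ 0) :
    charInner ρ.character (inducedRep ζ).character ≠ 0 := by
  have : Nontrivial (IntertwiningMap (inducedRep ζ) ρ) := by
    refine nontrivial_of_ne (indLift hy) 0 fun h ↦ hy0 ?_
    simpa [h] using (indLift_indMk hy 1).symm
  rw [charInner_character, Nat.cast_ne_zero]
  exact Module.finrank_pos.ne'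

variable (ζ) in
/-- The generator of the copy of the induced module inside the regular module. -/
def semiInvariantVector [Fintype P] : MonoidAlgebra ℂ G :=
  (Nat.card P : ℂ)⁻¹ • ∑ p : P, MonoidAlgebra.single (p : G) (ζ p⁻¹ : ℂ)

lemma leftRegular_semiInvariantVector [Fintype P] (p : P) :
    leftRegular ℂ G p (semiInvariantVector ζ) = (ζ p : ℂ) • semiInvariantVector ζ := by
  rw [semiInvariantVector, map_smul, map_sum, smul_comm (ζ p : ℂ),
    Finset.smul_sum (r := (ζ p : ℂ))]
  refine congrArg _ (Fintype.sum_equiv (Equiv.mulLeft p) _ _ fun x ↦ ?_)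
  have hζ : (ζ x⁻¹ : ℂ) = ζ p * ζ (p * x)⁻¹ := by
    rw [mul_comm, ← Units.val_mul, ← map_mul, mul_inv_rev, inv_mul_cancel_right]
  rw [ofMulAction_single, MonoidAlgebra.smul_single, hζ]
  rfl

open scoped Classical in
lemma coeff_semiInvariantVector [Fintype P] (x : G) : (semiInvariantVector ζ).coeff x =
    (Nat.card P : ℂ)⁻¹ * if h : x⁻¹ ∈ P then (ζ ⟨x⁻¹, h⟩ : ℂ) else 0 := by
  simp only [semiInvariantVector, MonoidAlgebra.coeff_smul, MonoidAlgebra.coeff_sum,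
    MonoidAlgebra.coeff_single, Finsupp.smul_apply, Finsupp.finsetSum_apply, smul_eq_mul]
  congr 1
  split_ifs with h
  · rw [Fintype.sum_eq_single ⟨x⁻¹, h⟩⁻¹ fun p hp ↦ Finsupp.single_eq_of_ne ?_]
    · simp
    · rintro rfl
      exact hp (by simp [Subtype.ext_iff])
  · refine Finset.sum_eq_zero fun p _ ↦ Finsupp.single_eq_of_ne ?_
    rintro rfl
    exact h (inv_mem p.2)

/-- The `G`-map from the regular module onto the induced module that sends `1` to `1 ⊗ 1`. -/
def leftRegularToInd : IntertwiningMap (leftRegular ℂ G) (inducedRep ζ) :=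
  (leftRegularMapEquiv (inducedRep ζ)).symm (indMk ζ 1)

lemma leftRegularToInd_single (g : G) (c : ℂ) :
    leftRegularToInd (ζ := ζ) (MonoidAlgebra.single g c) = c • indMk ζ g⁻¹ := by
  rw [← mul_one c, ← MonoidAlgebra.smul_single', map_smul, mul_one, leftRegularToInd,
    leftRegularMapEquiv_symm_single, inducedRep_indMk, one_mul]

lemma leftRegularToInd_indLift [Fintype P] (x : IndV P.subtype (linearRep ζ)) :
    leftRegularToInd (indLift (leftRegular_semiInvariantVector (ζ := ζ)) x) = x := by
  suffices (leftRegularToInd.comp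
      (indLift (leftRegular_semiInvariantVector (ζ := ζ)))).toLinearMap = LinearMap.id from
    LinearMap.congr_fun this x
  refine ind_linearMap_ext fun h ↦ ?_
  have hP : (Nat.card P : ℂ) ≠ 0 := Nat.cast_ne_zero.2 Nat.card_pos.ne'
  have hmk (p : P) : indMk ζ ((h⁻¹ * p)⁻¹) = (ζ p : ℂ) • indMk ζ h := by
    rw [mul_inv_rev, inv_inv, ← Subgroup.coe_inv, indMk_mul, map_inv, Units.val_inv_eq_inv_val,
      inv_inv]
  change leftRegularToInd (indLift leftRegular_semiInvariantVector (indMk ζ h)) = indMk ζ h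
  rw [indLift_indMk]
  simp only [semiInvariantVector, map_smul, map_sum, ofMulAction_single, smul_eq_mul,
    leftRegularToInd_single, hmk, smul_smul, map_inv, Units.val_inv_eq_inv_val,
    inv_mul_cancel₀ (ζ _).ne_zero, one_smul, Finset.sum_const, Finset.card_univ]
  rw [← Nat.card_eq_fintype_card, ← Nat.cast_smul_eq_nsmul ℂ, smul_smul, inv_mul_cancel₀ hP,
    one_smul]

open scoped Classical in
theorem character_inducedRep [Fintype G] (g : G) : (inducedRep ζ).character g =
    (Nat.card P : ℂ)⁻¹ * ∑ x, if h : x⁻¹ * g * x ∈ P then (ζ ⟨_, h⟩ : ℂ) else 0 := by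
  let e := indLift (leftRegular_semiInvariantVector (ζ := ζ))
  have htrace : (inducedRep ζ).character g =
      LinearMap.trace ℂ _ (e.toLinearMap ∘ₗ inducedRep ζ g ∘ₗ leftRegularToInd.toLinearMap) := by
    have hid : leftRegularToInd.toLinearMap ∘ₗ e.toLinearMap = LinearMap.id :=
      LinearMap.ext leftRegularToInd_indLift
    rw [LinearMap.trace_comp_comm', LinearMap.comp_assoc, hid, LinearMap.comp_id, character]
  rw [htrace, trace_monoidAlgebra, Finset.mul_sum]
  refine Finset.sum_congr rfl fun x _ ↦ ?_
  change (e (inducedRep ζ g (leftRegularToInd (MonoidAlgebra.single x 1)))).coeff x = _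
  rw [leftRegularToInd_single, one_smul, inducedRep_indMk, indLift_indMk, coeff_ofMulAction,
    coeff_semiInvariantVector]
  simp only [smul_eq_mul, mul_inv_rev, inv_inv, mul_assoc]

end InducedRepresentations

section Symplectic

variable {m : ℕ} {F : Type*} [Field F]

/-- The symplectic form as a bilinear form, giving access to Mathlib's theory of those. -/
def sympBilin (m : ℕ) (F : Type*) [Field F] : LinearMap.BilinForm F (V m F) :=
  Matrix.toBilin' (Matrix.J (Fin m) F)

lemma sympForm_eq_sympBilin (x y : V m F) : sympForm x y = sympBilin m F x y :=
  (Matrix.toBilin'_apply' _ _ _).symm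

lemma sympForm_add_left (x y z : V m F) : sympForm (x + y) z = sympForm x z + sympForm y z := by
  simp [sympForm_eq_sympBilin]

lemma sympForm_add_right (x y z : V m F) : sympForm x (y + z) = sympForm x y + sympForm x z := by
  simp [sympForm_eq_sympBilin]

lemma sympForm_smul_left (a : F) (x y : V m F) : sympForm (a • x) y = a * sympForm x y := by
  simp [sympForm_eq_sympBilin]

lemma sympForm_smul_right (a : F) (x y : V m F) : sympForm x (a • y) = a * sympForm x y := by
  simp [sympForm_eq_sympBilin]

lemma sympForm_zero_right (x : V m F) : sympForm x 0 = 0 := by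
  simp [sympForm_eq_sympBilin]

lemma sympForm_apply (x y : V m F) :
    sympForm x y = ∑ i, (x (.inr i) * y (.inl i) - x (.inl i) * y (.inr i)) := by
  simp [sympForm, Matrix.J, dotProduct, Matrix.fromBlocks_mulVec, Finset.sum_sub_distrib,
    Matrix.neg_mulVec]
  ring

lemma sympForm_self (x : V m F) : sympForm x x = 0 := by
  rw [sympForm_apply]
  exact Finset.sum_eq_zero fun i _ ↦ by ring

lemma sympForm_neg_comm (x y : V m F) : sympForm x y = - sympForm y x := by
  rw [sympForm_apply, sympForm_apply, ← Finset.sum_neg_distrib]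
  exact Finset.sum_congr rfl fun i _ ↦ by ring

lemma sympBilin_nondegenerate : (sympBilin m F).Nondegenerate :=
  LinearMap.BilinForm.nondegenerate_toBilin'_of_det_ne_zero' _ (Matrix.isUnit_det_J _ _).ne_zero

lemma exists_sympForm_eq (f : V m F →ₗ[F] F) : ∃ z, ∀ x, sympForm x z = f x := by
  obtain ⟨z, hz⟩ := ((sympBilin m F).toDual sympBilin_nondegenerate).surjective (-f)
  refine ⟨z, fun x ↦ ?_⟩
  rw [sympForm_neg_comm, sympForm_eq_sympBilin,
    ← LinearMap.BilinForm.toDual_def sympBilin_nondegenerate, hz]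
  simp

lemma eq_of_forall_sympForm_eq {y z : V m F} (h : ∀ x, sympForm x y = sympForm x z) : y = z := by
  refine ((sympBilin m F).toDual sympBilin_nondegenerate).injective (LinearMap.ext fun x ↦ ?_)
  rw [LinearMap.BilinForm.toDual_def, LinearMap.BilinForm.toDual_def, ← sympForm_eq_sympBilin,
    ← sympForm_eq_sympBilin, sympForm_neg_comm, h, ← sympForm_neg_comm]

lemma exists_sympForm_ne_zero {x : V m F} (hx : x ≠ 0) : ∃ y, sympForm x y ≠ 0 := by
  by_contra! h
  refine hx (eq_of_forall_sympForm_eq fun y ↦ ?_)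
  rw [sympForm_neg_comm, h, sympForm_zero_right, neg_zero]

lemma exists_sympForm_eq_of_linearIndependent {n : ℕ} {b : Fin n → V m F}
    (hb : LinearIndependent F b) (c : Fin n → F) : ∃ z, ∀ i, sympForm (b i) z = c i := by
  obtain ⟨f, hf⟩ := LinearMap.exists_extend ((Module.Basis.span hb).constr F c)
  obtain ⟨z, hz⟩ := exists_sympForm_eq f
  refine ⟨z, fun i ↦ ?_⟩
  have := LinearMap.congr_fun hf (Module.Basis.span hb i)
  rw [Module.Basis.constr_basis, LinearMap.comp_apply, Submodule.subtype_apply,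
    Module.Basis.span_apply] at this
  rw [hz, this]

lemma smul_eq_mulVec (g : Sp m F) (x : V m F) : g • x = (g : Matrix _ _ F).mulVec x := rfl

lemma sympForm_smul_smul (g : Sp m F) (x y : V m F) : sympForm (g • x) (g • y) = sympForm x y := by
  have h := SymplecticGroup.mem_iff'.1 g.2
  rw [smul_eq_mulVec, smul_eq_mulVec, sympForm, Matrix.mulVec_mulVec, Matrix.dotProduct_mulVec,
    Matrix.vecMul_mulVec, ← Matrix.dotProduct_mulVec, ← Matrix.mul_assoc, h, sympForm]

/-- A linear map preserving the symplectic form, as an element of the symplectic group. -/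
def Sp.ofLinearMap (f : V m F →ₗ[F] V m F) (hf : ∀ x y, sympForm (f x) (f y) = sympForm x y) :
    Sp m F :=
  ⟨LinearMap.toMatrix' f, by
    rw [SymplecticGroup.mem_iff']
    refine Matrix.toBilin'.injective (LinearMap.ext₂ fun x y ↦ ?_)
    rw [Matrix.toBilin'_apply', Matrix.toBilin'_apply']
    have := hf x y
    rw [sympForm, sympForm, ← LinearMap.toMatrix'_mulVec f x, ← LinearMap.toMatrix'_mulVec f y,
      Matrix.mulVec_mulVec, Matrix.dotProduct_mulVec, Matrix.vecMul_mulVec,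
      ← Matrix.dotProduct_mulVec, ← Matrix.mul_assoc] at this
    exact this⟩

lemma Sp.ofLinearMap_smul (f : V m F →ₗ[F] V m F)
    (hf : ∀ x y, sympForm (f x) (f y) = sympForm x y) (x : V m F) :
    Sp.ofLinearMap f hf • x = f x :=
  LinearMap.toMatrix'_mulVec f x

/-- The symplectic transvection `x ↦ x + t (x, u) u`. -/
def transvection (t : F) (u : V m F) : Sp m F :=
  Sp.ofLinearMap (LinearMap.id + t • (LinearMap.flip (sympBilin m F) u).smulRight u) fun x y ↦ by
    simp only [LinearMap.add_apply, LinearMap.id_apply, LinearMap.smul_apply,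
      LinearMap.smulRight_apply, LinearMap.flip_apply, ← sympForm_eq_sympBilin, sympForm_add_left,
      sympForm_add_right, sympForm_smul_left, sympForm_smul_right, sympForm_self]
    rw [sympForm_neg_comm u y]
    ring

lemma transvection_smul (t : F) (u x : V m F) :
    transvection t u • x = x + (t * sympForm x u) • u := by
  rw [transvection, Sp.ofLinearMap_smul]
  simp [sympForm_eq_sympBilin, mul_smul]

lemma transvection_smul_eq {x y : V m F} (h : sympForm x y ≠ 0) :
    transvection (sympForm x y)⁻¹ (y - x) • x = y := by
  rw [transvection_smul, sub_eq_add_neg, sympForm_add_right, ← neg_one_smul F x,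
    sympForm_smul_right, sympForm_self, mul_zero, add_zero, inv_mul_cancel₀ h]
  simp

lemma transvection_smul_eq_self {v x y : V m F} (t : F) (h : sympForm v x = sympForm v y) :
    transvection t (y - x) • v = v := by
  rw [transvection_smul, sub_eq_add_neg, sympForm_add_right, ← neg_one_smul F x,
    sympForm_smul_right, h]
  simp

lemma exists_mem_and_apply_ne_zero {A B : Type*} [AddMonoid A] [AddMonoid B] (S : AddSubmonoid A)
    {f g : A →+ B} (hf : ∃ a ∈ S, f a ≠ 0) (hg : ∃ a ∈ S, g a ≠ 0) :
    ∃ a ∈ S, f a ≠ 0 ∧ g a ≠ 0 := by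
  obtain ⟨a, haS, hfa⟩ := hf
  obtain ⟨b, hbS, hgb⟩ := hg
  by_cases hga : g a = 0
  · by_cases hfb : f b = 0
    · exact ⟨a + b, add_mem haS hbS, by simpa [hfb], by simpa [hga]⟩
    · exact ⟨b, hbS, hfb, hgb⟩
  · exact ⟨a, haS, hfa, hga⟩

theorem exists_stabilizer_smul_eq {v x y : V m F} (h : sympForm v x = sympForm v y)
    (hx : ∃ t, sympForm v t = 0 ∧ sympForm x t ≠ 0)
    (hy : ∃ t, sympForm v t = 0 ∧ sympForm y t ≠ 0) : ∃ g : Sp m F, g • v = v ∧ g • x = y := by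
  have key {x y : V m F} (hxy : sympForm x y ≠ 0) (h : sympForm v x = sympForm v y) :
      ∃ g : Sp m F, g • v = v ∧ g • x = y :=
    ⟨_, transvection_smul_eq_self _ h, transvection_smul_eq hxy⟩
  by_cases hxy : sympForm x y = 0
  swap
  · exact key hxy h
  obtain ⟨t, hvt, hxt, hyt⟩ : ∃ t, sympForm v t = 0 ∧ sympForm x t ≠ 0 ∧ sympForm y t ≠ 0 := by
    simp only [sympForm_eq_sympBilin] at hx hy ⊢
    exact exists_mem_and_apply_ne_zero (LinearMap.ker (sympBilin m F v)).toAddSubmonoid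
      (f := (sympBilin m F x).toAddMonoidHom) (g := (sympBilin m F y).toAddMonoidHom) hx hy
  have hvz : sympForm v (x + t) = sympForm v x := by rw [sympForm_add_right, hvt, add_zero]
  obtain ⟨g, hgv, hg⟩ := key (x := x) (y := x + t)
    (by rwa [sympForm_add_right, sympForm_self, zero_add]) hvz.symm
  obtain ⟨k, hkv, hk⟩ := key (x := x + t) (y := y)
    (by rwa [sympForm_add_left, hxy, zero_add, sympForm_neg_comm, neg_ne_zero]) (hvz.trans h)
  exact ⟨k * g, by rw [mul_smul, hgv, hkv], by rw [mul_smul, hg, hk]⟩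

lemma exists_smul_eq {x y : V m F} (hx : x ≠ 0) (hy : y ≠ 0) : ∃ g : Sp m F, g • x = y := by
  have hzero (t : V m F) : sympForm 0 t = 0 := by
    rw [sympForm_neg_comm, sympForm_zero_right, neg_zero]
  obtain ⟨g, -, hg⟩ := exists_stabilizer_smul_eq (v := 0) (x := x) (y := y) (by simp only [hzero])
    (by simpa only [hzero, true_and] using exists_sympForm_ne_zero hx)
    (by simpa only [hzero, true_and] using exists_sympForm_ne_zero hy)
  exact ⟨g, hg⟩

lemma linearIndependent_smul_pair {x y : V m F} (h : LinearIndependent F ![x, y]) (g : Sp m F) :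
    LinearIndependent F ![g • x, g • y] := by
  rw [LinearIndependent.pair_iff] at h ⊢
  intro s t hst
  rw [← smul_comm g, ← smul_comm g, ← smul_add, smul_eq_zero_iff_eq] at hst
  exact h s t hst

/-- Witt's theorem for pairs of independent vectors. -/
theorem exists_smul_pair_eq {x y x' y' : V m F} (h : LinearIndependent F ![x, y])
    (h' : LinearIndependent F ![x', y']) (hxy : sympForm x y = sympForm x' y') :
    ∃ g : Sp m F, g • x = x' ∧ g • y = y' := by
  have hdual {v w : V m F} (hvw : LinearIndependent F ![v, w]) :
      ∃ t, sympForm v t = 0 ∧ sympForm w t ≠ 0 := by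
    obtain ⟨t, ht⟩ := exists_sympForm_eq_of_linearIndependent hvw ![0, 1]
    exact ⟨t, ht 0, (ht 1).trans_ne one_ne_zero⟩
  obtain ⟨g, rfl⟩ : ∃ g : Sp m F, g • x = x' := exists_smul_eq (h.ne_zero 0) (h'.ne_zero 0)
  obtain ⟨k, hk, hky⟩ := exists_stabilizer_smul_eq (v := g • x) (x := g • y) (y := y')
    (by rwa [sympForm_smul_smul]) (hdual (linearIndependent_smul_pair h g)) (hdual h')
  exact ⟨k * g, by rw [mul_smul, hk], by rw [mul_smul, hky]⟩

end Symplectic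

section Forms

open Representation MonoidAlgebra

lemma orbit_eq_compl_of_card_le_two {G X : Type*} [Group G] [MulAction G X] [Finite X]
    (h : Nat.card (MulAction.orbitRel.Quotient G X) ≤ 2) {x y : X}
    (hxy : y ∉ MulAction.orbit G x) : MulAction.orbit G y = (MulAction.orbit G x)ᶜ := by
  have := Fintype.ofFinite (MulAction.orbitRel.Quotient G X)
  ext z
  refine ⟨fun hzy hzx ↦ hxy ?_, fun hzx ↦ ?_⟩
  · rw [← MulAction.orbit_eq_iff.2 hzx, MulAction.orbit_eq_iff.2 hzy]
    exact MulAction.mem_orbit_self y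
  · by_contra hzy
    refine h.not_gt ?_
    rw [Nat.card_eq_fintype_card, Fintype.two_lt_card_iff]
    refine ⟨Quotient.mk'' x, Quotient.mk'' y, Quotient.mk'' z, ?_, ?_, ?_⟩
    all_goals rw [Ne, eq_comm, Quotient.eq'', MulAction.orbitRel_apply]
    exacts [hxy, hzx, hzy]

variable {m : ℕ} {F : Type*} [Field F]

/-- The quadratic forms polarizing to the standard symplectic form. -/
abbrev Forms (m : ℕ) (F : Type*) [Field F] : Type _ :=
  {Q : QuadraticForm F (V m F) // PolarizesToSymp Q}

namespace Forms

lemma map_add (Q : Forms m F) (x y : V m F) :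
    Q.1 (x + y) = Q.1 x + Q.1 y + sympForm x y := by
  rw [← Q.2 x y, QuadraticMap.polar]
  ring

lemma ext {Q Q' : Forms m F} (h : ∀ x, Q.1 x = Q'.1 x) : Q = Q' :=
  Subtype.ext (QuadraticMap.ext h)

instance : MulAction (Sp m F) (Forms m F) where
  smul g Q := ⟨Q.1.comp (DistribSMul.toLinearMap F (V m F) g⁻¹), fun x y ↦ by
    rw [← sympForm_smul_smul g⁻¹, ← Q.2]
    simp [QuadraticMap.polar]⟩
  one_smul Q := by
    refine Forms.ext fun x ↦ ?_
    change Q.1 ((1 : Sp m F)⁻¹ • x) = Q.1 x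
    rw [inv_one, one_smul]
  mul_smul g h Q := by
    refine Forms.ext fun x ↦ ?_
    change Q.1 ((g * h)⁻¹ • x) = Q.1 (h⁻¹ • g⁻¹ • x)
    rw [mul_inv_rev, mul_smul]

lemma smul_apply (g : Sp m F) (Q : Forms m F) (x : V m F) : (g • Q).1 x = Q.1 (g⁻¹ • x) :=
  rfl

lemma stabilizer_eq_orthogonalSubgroup (Q : Forms m F) :
    MulAction.stabilizer (Sp m F) Q = orthogonalSubgroup Q.1 := by
  ext g
  refine ⟨fun h x ↦ ?_, fun h ↦ ext fun x ↦ ?_⟩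
  · conv_lhs => rw [← MulAction.mem_stabilizer_iff.1 h, smul_apply, inv_smul_smul]
  · rw [smul_apply, ← h (g⁻¹ • x), smul_inv_smul]

/-- The cosets of the orthogonal group of `Q`, identified with the orbit of `Q` in order to make
quadratic forms available on `Ω^ε`. -/
def cosetsEquivOrbit (Q : Forms m F) :
    Sp m F ⧸ orthogonalSubgroup Q.1 ≃ MulAction.orbit (Sp m F) Q :=
  (Subgroup.quotientEquivOfEq Q.stabilizer_eq_orthogonalSubgroup.symm).trans
    (MulAction.orbitEquivQuotientStabilizer (Sp m F) Q).symm

lemma cosetsEquivOrbit_mk (Q : Forms m F) (k : Sp m F) :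
    (Q.cosetsEquivOrbit k : Forms m F) = k • Q := rfl

lemma cosetsEquivOrbit_smul (Q : Forms m F) (g : Sp m F) (c : Sp m F ⧸ orthogonalSubgroup Q.1) :
    Q.cosetsEquivOrbit (g • c) = g • Q.cosetsEquivOrbit c := by
  induction c using QuotientGroup.induction_on with
  | H k => exact Subtype.ext (mul_smul g k Q)

lemma notMem_orbit_of_isPlusType_of_isMinusType {Qp Qm : Forms m F} (hp : IsPlusType Qp.1)
    (hm : IsMinusType Qm.1) : Qm ∉ MulAction.orbit (Sp m F) Qp := by
  rintro ⟨g, rfl⟩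
  obtain ⟨W, hW, hWm⟩ := hp.exists_singular
  let e : V m F ≃ₗ[F] V m F := DistribMulAction.toLinearEquiv F (V m F) g
  have hgW : IsTotallySingular (g • Qp).1 (W.map e.toLinearMap) := by
    rintro _ ⟨w, hw, rfl⟩
    change Qp.1 (g⁻¹ • g • w) = 0
    rw [inv_smul_smul, hW w hw]
  exact (hm.finrank_lt _ hgW).ne ((LinearEquiv.finrank_map_eq e W).trans hWm)

instance [Finite F] : Finite (Forms m F) :=
  Finite.of_injective (fun Q x ↦ Q.1 x : Forms m F → V m F → F) fun _ _ h ↦ ext (congrFun h)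

end Forms

instance [Finite F] : Fintype (Sp m F) := by
  classical exact Fintype.ofFinite _

lemma card_orbits_vectors_le :
    Nat.card (MulAction.orbitRel.Quotient (Sp m F) (V m F)) ≤ 2 := by
  have : Function.Injective (fun c : MulAction.orbitRel.Quotient (Sp m F) (V m F) ↦
      (c = Quotient.mk'' 0 : Prop)) := by
    intro a b
    induction a using Quotient.inductionOn' with | _ x
    induction b using Quotient.inductionOn' with | _ y
    simp only [Quotient.eq'', MulAction.orbitRel_apply, MulAction.mem_orbit_iff, smul_zero,
      exists_const, eq_iff_iff]
    intro h
    by_cases hx : x = 0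
    · exact ⟨1, by simp [← h.1 hx.symm, hx]⟩
    · exact exists_smul_eq (fun hy ↦ hx (h.2 hy.symm).symm) hx
  simpa using Nat.card_le_card_of_injective _ this

lemma exists_addChar_ne_one (F : Type*) [Field F] [Finite F] : ∃ ψ : AddChar F ℂ, ψ ≠ 1 := by
  have := AddChar.FiniteField.primitiveChar_to_Complex_isPrimitive (F := F) one_ne_zero
  exact ⟨_, by rwa [AddChar.mulShift_one] at this⟩

section FormsToVectors

variable [Fintype F]

/-- The intertwining map `Q ↦ ∑ x, ψ (Q x) • x` from the permutation module on forms to the one on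
vectors, given by an additive character `ψ` of the field. -/
def formsToVectors (m : ℕ) (ψ : AddChar F ℂ) :
    IntertwiningMap (permModule (Sp m F) (Forms m F)) (permModule (Sp m F) (V m F)) where
  toLinearMap := Finsupp.linearCombination ℂ
    (fun Q : Forms m F ↦ ∑ x : V m F, single x (ψ (Q.1 x))) ∘ₗ (coeffLinearEquiv ℂ).toLinearMap
  isIntertwining' g := by
    refine MonoidAlgebra.lhom_ext' fun Q ↦ LinearMap.ext_ring ?_
    simp only [ofMulAction_def, LinearMap.coe_comp, LinearEquiv.coe_coe, Function.comp_apply,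
      lsingle_apply, coeffLinearEquiv_apply, coeff_single, Finsupp.lmapDomain_apply,
      Finsupp.mapDomain_single, coeffLinearEquiv_symm_apply, ofCoeff_single,
      Finsupp.linearCombination_single, one_smul, map_sum, Forms.smul_apply]
    exact Fintype.sum_equiv (MulAction.toPerm g⁻¹) _ _ fun x ↦ by simp

lemma coeff_formsToVectors [Fintype (Forms m F)] (ψ : AddChar F ℂ)
    (f : MonoidAlgebra ℂ (Forms m F)) (x : V m F) :
    (formsToVectors m ψ f).coeff x = ∑ Q, f.coeff Q * ψ (Q.1 x) := by
  classical
  change (Finsupp.linearCombination ℂ (fun Q : Forms m F ↦ ∑ x : V m F,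
    single x (ψ (Q.1 x))) f.coeff : MonoidAlgebra ℂ (V m F)).coeff x = _
  rw [Finsupp.linearCombination_apply, Finsupp.sum_fintype _ _ (by simp)]
  simp [Finsupp.single_apply]

end FormsToVectors

section CharTwo

variable [CharP F 2]

namespace Forms

/-- The form `Q + (·, b)²`. In characteristic two these make the set of all forms a torsor under
the additive group of `V`. -/
def addSq (Q : Forms m F) (b : V m F) : Forms m F :=
  ⟨Q.1 + QuadraticMap.linMulLin (LinearMap.flip (sympBilin m F) b)
      (LinearMap.flip (sympBilin m F) b), fun x y ↦ by
    have h2 : (2 : F) = 0 := CharTwo.two_eq_zero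
    rw [← Q.2 x y]
    simp only [QuadraticMap.polar, add_apply, QuadraticMap.linMulLin_apply, _root_.map_add]
    linear_combination
      (LinearMap.flip (sympBilin m F) b x * LinearMap.flip (sympBilin m F) b y) * h2⟩

lemma addSq_apply (Q : Forms m F) (b x : V m F) :
    (Q.addSq b).1 x = Q.1 x + sympForm x b ^ 2 := by
  simp [addSq, sympForm_eq_sympBilin, sq]

lemma addSq_bijective [PerfectRing F 2] (Q : Forms m F) : Function.Bijective Q.addSq := by
  constructor
  · intro b c h
    refine eq_of_forall_sympForm_eq fun x ↦ CharTwo.sq_injective ?_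
    have := congrArg (fun R : Forms m F ↦ R.1 x) h
    simpa only [addSq_apply, add_right_inj] using this
  · intro R
    let f : V m F →ₗ[F] F :=
      { toFun := fun x ↦ (frobeniusEquiv F 2).symm (R.1 x - Q.1 x)
        map_add' := fun x y ↦ by
          rw [← _root_.map_add, R.map_add, Q.map_add]
          congr 1
          ring
        map_smul' := fun a x ↦ by
          rw [QuadraticMap.map_smul, QuadraticMap.map_smul, ← smul_sub, smul_eq_mul, _root_.map_mul,
            ← sq, frobeniusEquiv_symm_pow, RingHom.id_apply, smul_eq_mul] }
    have hf (x : V m F) : f x ^ 2 = R.1 x - Q.1 x := frobeniusEquiv_symm_pow_p F 2 _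
    obtain ⟨b, hb⟩ := exists_sympForm_eq f
    exact ⟨b, ext fun x ↦ by rw [addSq_apply, hb, hf, add_sub_cancel]⟩

lemma card_eq [PerfectRing F 2] (Q : Forms m F) : Nat.card (Forms m F) = Nat.card (V m F) :=
  (Nat.card_congr (Equiv.ofBijective _ Q.addSq_bijective)).symm

lemma sum_addChar_sub [Fintype F] {ψ : AddChar F ℂ} (hψ : ψ ≠ 1) {Q R : Forms m F} (h : Q ≠ R) :
    ∑ x : V m F, ψ (Q.1 x - R.1 x) = 0 := by
  let χ : AddChar (V m F) ℂ :=
    { toFun := fun x ↦ ψ (Q.1 x - R.1 x)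
      map_zero_eq_one' := by simp
      map_add_eq_mul' := fun x y ↦ by
        rw [← AddChar.map_add_eq_mul, R.map_add, Q.map_add]
        congr 1
        ring }
  refine AddChar.sum_eq_zero_of_ne_one (ψ := χ) fun hχ ↦ h (ext fun x ↦ ?_)
  by_contra hx
  refine hψ (DFunLike.ext _ _ fun c ↦ ?_)
  obtain ⟨a, ha⟩ : ∃ a : F, a ^ 2 = c * (Q.1 x - R.1 x)⁻¹ := surjective_frobenius F 2 _
  have := DFunLike.congr_fun hχ (a • x)
  change ψ (Q.1 (a • x) - R.1 (a • x)) = 1 at this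
  rwa [QuadraticMap.map_smul, QuadraticMap.map_smul, ← smul_sub, smul_eq_mul, ← sq, ha,
    inv_mul_cancel_right₀ (sub_ne_zero.2 hx)] at this

end Forms

variable [Fintype F]

lemma formsToVectors_injective {ψ : AddChar F ℂ} (hψ : ψ ≠ 1) :
    Function.Injective (formsToVectors m ψ) := by
  have := Fintype.ofFinite (Forms m F)
  refine (injective_iff_map_eq_zero (formsToVectors m ψ).toLinearMap).2 fun f hf ↦ ?_
  refine MonoidAlgebra.ext (Finsupp.ext fun R ↦ ?_)
  have hcoeff (x : V m F) : ∑ Q, f.coeff Q * ψ (Q.1 x) = 0 := by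
    rw [← coeff_formsToVectors]
    exact congrArg (fun k : MonoidAlgebra ℂ (V m F) ↦ k.coeff x) hf
  have hsum : ∑ Q, f.coeff Q * ∑ x : V m F, ψ (Q.1 x - R.1 x) = 0 := by
    simp_rw [Finset.mul_sum]
    rw [Finset.sum_comm]
    refine Finset.sum_eq_zero fun x _ ↦ ?_
    have := congrArg (· * ψ (-R.1 x)) (hcoeff x)
    simpa [Finset.sum_mul, mul_assoc, ← AddChar.map_add_eq_mul, ← sub_eq_add_neg] using this
  rw [Fintype.sum_eq_single R fun Q hQ ↦ by rw [Forms.sum_addChar_sub hψ hQ, mul_zero]] at hsum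
  simpa using hsum

lemma nonempty_forms_equiv_vectors (Q : Forms m F) :
    Nonempty ((permModule (Sp m F) (Forms m F)).Equiv (permModule (Sp m F) (V m F))) := by
  obtain ⟨ψ, hψ⟩ := exists_addChar_ne_one F
  refine ⟨(formsToVectors m ψ).ofBijective ⟨formsToVectors_injective hψ, ?_⟩⟩
  refine (LinearMap.injective_iff_surjective_of_finrank_eq_finrank
    (f := (formsToVectors m ψ).toLinearMap) ?_).1 (formsToVectors_injective hψ)
  rw [finrank_monoidAlgebra, finrank_monoidAlgebra, Q.card_eq]

omit [Fintype F] in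
lemma Forms.orbit_eq_compl [Finite F] {Qp Qm : Forms m F} (h : Qm ∉ MulAction.orbit (Sp m F) Qp) :
    MulAction.orbit (Sp m F) Qm = (MulAction.orbit (Sp m F) Qp)ᶜ := by
  have := Fintype.ofFinite F
  obtain ⟨e⟩ := nonempty_forms_equiv_vectors Qp
  refine orbit_eq_compl_of_card_le_two (le_of_eq_of_le ?_
    (card_orbits_vectors_le (m := m) (F := F))) h
  have := charInner_permChar_one (G := Sp m F) (X := Forms m F)
  rw [permChar, char_iso e, charInner_permChar_one, Nat.cast_inj] at this
  exact this.symm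

theorem nonempty_vectors_equiv_cosets {Qp Qm : Forms m F}
    (h : Qm ∉ MulAction.orbit (Sp m F) Qp) :
    Nonempty ((permModule (Sp m F) (V m F)).Equiv
      ((permModule (Sp m F) (Sp m F ⧸ orthogonalSubgroup Qp.1)).prod
        (permModule (Sp m F) (Sp m F ⧸ orthogonalSubgroup Qm.1)))) := by
  classical
  obtain ⟨e⟩ := nonempty_forms_equiv_vectors Qp
  let e' : (Sp m F ⧸ orthogonalSubgroup Qp.1) ⊕ (Sp m F ⧸ orthogonalSubgroup Qm.1) ≃ Forms m F :=
    (Qp.cosetsEquivOrbit.sumCongr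
      (Qm.cosetsEquivOrbit.trans (Equiv.setCongr (Forms.orbit_eq_compl h)))).trans
      (Equiv.Set.sumCompl _)
  refine ⟨e.symm.trans (permModuleProd e' (fun g c ↦ ?_) fun g c ↦ ?_)⟩
  · exact congrArg Subtype.val (Qp.cosetsEquivOrbit_smul g c)
  · exact congrArg Subtype.val (Qm.cosetsEquivOrbit_smul g c)

lemma permChar_vectors_eq_add {Qp Qm : Forms m F} (h : Qm ∉ MulAction.orbit (Sp m F) Qp) :
    permChar (Sp m F) (V m F) = permChar (Sp m F) (Sp m F ⧸ orthogonalSubgroup Qp.1) +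
        permChar (Sp m F) (Sp m F ⧸ orthogonalSubgroup Qm.1) := by
  obtain ⟨e⟩ := nonempty_vectors_equiv_cosets h
  rw [permChar, char_iso e, character_prod]

end CharTwo

end Forms

section Degrees

variable {m : ℕ} {F : Type*} [Field F]

lemma mem_of_forall_sympForm_eq_zero {W : Submodule F (V m F)} (hW : Module.finrank F W = m)
    (hiso : ∀ x ∈ W, ∀ y ∈ W, sympForm x y = 0) {b : V m F} (hb : ∀ w ∈ W, sympForm b w = 0) :
    b ∈ W := by
  let Wperp := LinearMap.BilinForm.orthogonal (sympBilin m F) W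
  have hle : W ≤ Wperp := fun x hx y hy ↦ by
    rw [← sympForm_eq_sympBilin]
    exact hiso y hy x hx
  have hfin : Module.finrank F W = Module.finrank F Wperp := by
    rw [LinearMap.BilinForm.finrank_orthogonal sympBilin_nondegenerate, hW,
      Module.finrank_fintype_fun_eq_card, Fintype.card_sum, Fintype.card_fin, Nat.add_sub_cancel]
  rw [Submodule.eq_of_le_of_finrank_eq hle hfin]
  intro w hw
  rw [← sympForm_eq_sympBilin, sympForm_neg_comm, hb w hw, neg_zero]

namespace Forms

lemma sympForm_eq_zero_of_isTotallySingular (Q : Forms m F) {W : Submodule F (V m F)}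
    (hW : IsTotallySingular Q.1 W) : ∀ x ∈ W, ∀ y ∈ W, sympForm x y = 0 := fun x hx y hy ↦ by
  have := Q.map_add x y
  rw [hW x hx, hW y hy, hW _ (W.add_mem hx hy)] at this
  simpa using this.symm

end Forms

section GaussSum

variable {R : Type*} [CommRing R] [IsDomain R] {ψ : AddChar F R}

lemma sum_addChar_sympForm_eq_zero (hψ : ψ ≠ 1) {W : Submodule F (V m F)} [Fintype W] {b : V m F}
    (hb : ∃ w ∈ W, sympForm b w ≠ 0) : ∑ w : W, ψ (sympForm b (w : V m F)) = 0 := by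
  let χ : AddChar W R :=
    { toFun := fun w ↦ ψ (sympForm b (w : V m F))
      map_zero_eq_one' := by simp [sympForm_zero_right]
      map_add_eq_mul' := fun x y ↦ by
        rw [← AddChar.map_add_eq_mul, ← sympForm_add_right, Submodule.coe_add] }
  refine AddChar.sum_eq_zero_of_ne_one (ψ := χ) fun hχ ↦ ?_
  obtain ⟨w, hw, hbw⟩ := hb
  obtain ⟨c, hc⟩ := (AddChar.ne_one_iff).1 hψ
  have := DFunLike.congr_fun hχ ((c / sympForm b w) • (⟨w, hw⟩ : W))
  change ψ (sympForm b ((c / sympForm b w) • w)) = 1 at this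
  rw [sympForm_smul_right, div_mul_cancel₀ _ hbw] at this
  exact hc this

lemma Forms.sum_addChar_eq_card [Fintype F] [CharZero R] (hψ : ψ ≠ 1) (Q : Forms m F)
    {W : Submodule F (V m F)} (hW : IsTotallySingular Q.1 W) (hWm : Module.finrank F W = m) :
    ∑ b : V m F, ψ (Q.1 b) = (Nat.card W : R) := by
  classical
  have hiso := Q.sympForm_eq_zero_of_isTotallySingular hW
  have hinner (b : V m F) : ψ (Q.1 b) * ∑ w : W, ψ (sympForm b (w : V m F)) =
      if b ∈ W then (Fintype.card W : R) else 0 := by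
    split_ifs with hb
    · simp [hiso b hb, hW b hb]
    · refine mul_eq_zero_of_right _ (sum_addChar_sympForm_eq_zero hψ ?_)
      by_contra! h
      exact hb (mem_of_forall_sympForm_eq_zero hWm hiso h)
  rw [Nat.card_eq_fintype_card]
  refine mul_left_cancel₀ (Nat.cast_ne_zero.2 (Fintype.card_ne_zero (α := W))) ?_
  calc (Fintype.card W : R) * ∑ b : V m F, ψ (Q.1 b)
      = ∑ w : W, ∑ b : V m F, ψ (Q.1 (b + w)) := by
        have (w : W) : ∑ b : V m F, ψ (Q.1 (b + w)) = ∑ b : V m F, ψ (Q.1 b) :=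
          Equiv.sum_comp (Equiv.addRight (w : V m F)) fun b ↦ ψ (Q.1 b)
        simp [this]
    _ = ∑ b : V m F, ψ (Q.1 b) * ∑ w : W, ψ (sympForm b (w : V m F)) := by
        rw [Finset.sum_comm]
        refine Finset.sum_congr rfl fun b _ ↦ ?_
        rw [Finset.mul_sum]
        refine Finset.sum_congr rfl fun w _ ↦ ?_
        rw [Q.map_add, hW w w.2, add_zero, AddChar.map_add_eq_mul]
    _ = (Fintype.card W : R) * Fintype.card W := by
        rw [Finset.sum_congr rfl fun b _ ↦ hinner b, ← Finset.sum_filter, Finset.sum_const,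
          nsmul_eq_mul, ← Fintype.card_subtype]

end GaussSum

section ArtinSchreier

variable [CharP F 2]

/-- The Artin–Schreier map `s ↦ s² + s`. Replacing `Q` by `Q + (·, b)²` preserves the isometry type
of `Q` when `Q b` lies in its range. -/
def artinSchreier (F : Type*) [Field F] [CharP F 2] : F →+ F where
  toFun s := s ^ 2 + s
  map_zero' := by simp
  map_add' x y := by rw [CharTwo.add_sq]; ring

lemma artinSchreier_apply (s : F) : artinSchreier F s = s ^ 2 + s := rfl

lemma index_range_artinSchreier [Finite F] : (artinSchreier F).range.index = 2 := by
  have hker : Nat.card (artinSchreier F).ker = 2 := by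
    have : ((artinSchreier F).ker : Set F) = {0, 1} := by
      ext x
      simp only [SetLike.mem_coe, AddMonoidHom.mem_ker, artinSchreier_apply, Set.mem_insert_iff,
        Set.mem_singleton_iff]
      rw [show x ^ 2 + x = x * (x + 1) by ring, mul_eq_zero, CharTwo.add_eq_zero]
    rw [← SetLike.coe_sort_coe, this, Nat.card_coe_set_eq, Set.ncard_pair zero_ne_one]
  have h1 := (artinSchreier F).ker.card_mul_index
  have h2 := (artinSchreier F).range.card_mul_index
  rw [AddSubgroup.index_ker, hker, ← h2, mul_comm] at h1
  exact (Nat.eq_of_mul_eq_mul_left Nat.card_pos h1).symm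

open scoped Classical in
/-- The additive character of `F` of order two whose kernel is the range of the Artin–Schreier map:
its value at `Q b` is the sign of `Q + (·, b)²` relative to `Q`. -/
def signChar (F : Type*) [Field F] [CharP F 2] [Finite F] : AddChar F ℤ where
  toFun c := if c ∈ (artinSchreier F).range then 1 else -1
  map_zero_eq_one' := by simp [zero_mem]
  map_add_eq_mul' a b := by
    have := AddSubgroup.add_mem_iff_of_index_two (a := a) (b := b)
      (index_range_artinSchreier (F := F))
    by_cases ha : a ∈ (artinSchreier F).range <;> by_cases hb : b ∈ (artinSchreier F).range <;>
      simp [this, ha, hb]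

lemma signChar_of_mem [Finite F] {c : F} (hc : c ∈ (artinSchreier F).range) : signChar F c = 1 :=
  if_pos hc

lemma signChar_of_notMem [Finite F] {c : F} (hc : c ∉ (artinSchreier F).range) :
    signChar F c = -1 :=
  if_neg hc

lemma signChar_ne_one [Finite F] : signChar F ≠ 1 := by
  intro h
  have htop : (artinSchreier F).range = ⊤ := by
    refine eq_top_iff.2 fun c _ ↦ ?_
    by_contra hc
    have := DFunLike.congr_fun h c
    rw [signChar_of_notMem hc, AddChar.one_apply] at this
    norm_num at this
  have := index_range_artinSchreier (F := F)
  rw [htop, AddSubgroup.index_top] at this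
  norm_num at this

lemma exists_sq_mul_add_eq_one {c : F} (hc : c ∈ (artinSchreier F).range) :
    ∃ t : F, t ^ 2 * c + t = 1 := by
  obtain ⟨s, rfl⟩ := hc
  rw [artinSchreier_apply]
  by_cases h0 : s ^ 2 + s = 0
  · exact ⟨1, by simp [h0]⟩
  · exact ⟨s / (s ^ 2 + s), by rw [div_pow, div_mul_eq_mul_div, sq (s ^ 2 + s),
      mul_div_mul_right _ _ h0, ← add_div, div_self h0]⟩

namespace Forms

lemma addSq_mem_orbit (Q : Forms m F) {b : V m F} (hb : Q.1 b ∈ (artinSchreier F).range) :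
    Q.addSq b ∈ MulAction.orbit (Sp m F) Q := by
  obtain ⟨t, ht⟩ := exists_sq_mul_add_eq_one hb
  refine ⟨(transvection t b)⁻¹, Forms.ext fun x ↦ ?_⟩
  change ((transvection t b)⁻¹ • Q).1 x = _
  rw [smul_apply, inv_inv, transvection_smul, Q.map_add, QuadraticMap.map_smul, addSq_apply,
    sympForm_smul_right, smul_eq_mul]
  linear_combination sympForm x b ^ 2 * ht

lemma card_lt_two_mul_card_orbit [Finite F] (Q : Forms m F) (hQ : IsPlusType Q.1) :
    Nat.card (Forms m F) < 2 * Nat.card (MulAction.orbit (Sp m F) Q) := by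
  classical
  have := Fintype.ofFinite F
  obtain ⟨W, hW, hWm⟩ := hQ.exists_singular
  let B : Finset (V m F) := {b | Q.1 b ∈ (artinSchreier F).range}
  have hle : B.card ≤ Nat.card (MulAction.orbit (Sp m F) Q) := by
    rw [← Nat.card_eq_finsetCard]
    exact Nat.card_le_card_of_injective
      (fun b : B ↦ (⟨Q.addSq b, Q.addSq_mem_orbit (Finset.mem_filter.1 b.2).2⟩ :
        MulAction.orbit (Sp m F) Q))
      fun a b hab ↦ Subtype.ext (Q.addSq_bijective.1 (congrArg Subtype.val hab))
  have hB : ∑ b ∈ B, signChar F (Q.1 b) = B.card := by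
    rw [Finset.card_eq_sum_ones, Nat.cast_sum, Nat.cast_one]
    exact Finset.sum_congr rfl fun b hb ↦ signChar_of_mem (Finset.mem_filter.1 hb).2
  have hBc : ∑ b ∈ Bᶜ, signChar F (Q.1 b) = -Bᶜ.card := by
    rw [Finset.card_eq_sum_ones, Nat.cast_sum, Nat.cast_one, ← Finset.sum_neg_distrib]
    exact Finset.sum_congr rfl fun b hb ↦ signChar_of_notMem (by simpa [B] using hb)
  have hsum := Q.sum_addChar_eq_card (signChar_ne_one (F := F)) hW hWm
  rw [← Finset.sum_add_sum_compl B, hB, hBc] at hsum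
  have htot := Finset.card_add_card_compl B
  rw [← Nat.card_eq_fintype_card, ← Q.card_eq] at htot
  have hpos : 0 < Nat.card W := Nat.card_pos
  omega

end Forms

lemma card_cosets_lt [Finite F] {Qp Qm : Forms m F} (hp : IsPlusType Qp.1)
    (hm : IsMinusType Qm.1) :
    Nat.card (Sp m F ⧸ orthogonalSubgroup Qm.1) < Nat.card (Sp m F ⧸ orthogonalSubgroup Qp.1) := by
  have := Fintype.ofFinite F
  have hlt := Qp.card_lt_two_mul_card_orbit hp
  have hadd := Set.ncard_add_ncard_compl (MulAction.orbit (Sp m F) Qp)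
  rw [← Forms.orbit_eq_compl (Forms.notMem_orbit_of_isPlusType_of_isMinusType hp hm)] at hadd
  rw [Nat.card_congr Qm.cosetsEquivOrbit, Nat.card_congr Qp.cosetsEquivOrbit]
  simp only [Nat.card_coe_set_eq] at hlt ⊢
  omega

lemma re_one_lt_of_permChar_eq [Finite F] {Qp Qm : Forms m F} (hp : IsPlusType Qp.1)
    (hm : IsMinusType Qm.1) {χp χm φ : Sp m F → ℂ}
    (hχp : permChar (Sp m F) (Sp m F ⧸ orthogonalSubgroup Qp.1) = 1 + χp + φ)
    (hχm : permChar (Sp m F) (Sp m F ⧸ orthogonalSubgroup Qm.1) = 1 + χm + φ) :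
    (χm 1).re < (χp 1).re := by
  have hlt := Nat.cast_lt (α := ℝ).2 (card_cosets_lt hp hm)
  rw [← permChar_one_re (G := Sp m F), ← permChar_one_re (G := Sp m F), hχp, hχm] at hlt
  simpa only [Pi.add_apply, Complex.add_re, add_lt_add_iff_right, add_lt_add_iff_left] using hlt

end ArtinSchreier

end Degrees

section CharactersOfUnits

variable {A : Type*} [CommGroup A]

instance [Finite A] : Fintype (A →* ℂˣ) := Fintype.ofFinite _

variable [Fintype A]

lemma sum_character [DecidableEq (A →* ℂˣ)] (η : A →* ℂˣ) :
    ∑ a, (η a : ℂ) = if η = 1 then (Fintype.card A : ℂ) else 0 := by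
  classical
  have hη : (Units.coeHom ℂ).comp η = 1 ↔ η = 1 := by
    simp [MonoidHom.ext_iff]
  simpa [hη] using sum_hom_units ((Units.coeHom ℂ).comp η)

lemma card_characters : Fintype.card (A →* ℂˣ) = Fintype.card A := by
  have := CommGroup.card_monoidHom_of_hasEnoughRootsOfUnity A ℂ
  simpa only [Nat.card_eq_fintype_card] using this

lemma sum_characters [DecidableEq A] (a : A) :
    ∑ η : A →* ℂˣ, (η a : ℂ) = if a = 1 then (Fintype.card A : ℂ) else 0 := by
  split_ifs with h
  · simp [h, card_characters]
  · obtain ⟨ξ, hξ⟩ := CommGroup.exists_apply_ne_one_of_hasEnoughRootsOfUnity A ℂ h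
    refine eq_zero_of_mul_eq_self_left (b := (ξ a : ℂ)) (by simpa using hξ) ?_
    rw [Finset.mul_sum]
    exact Fintype.sum_equiv (Equiv.mulLeft ξ) _ _ fun η ↦ by simp

end CharactersOfUnits

section NonzeroVectors

variable {m : ℕ} {F : Type*} [Field F]

/-- The nonzero vectors, on which `Sp m F` and `Fˣ` have commuting actions. -/
abbrev NV (m : ℕ) (F : Type*) [Field F] : Type _ := {u : V m F // u ≠ 0}

instance : MulAction (Sp m F) (NV m F) where
  smul g u := ⟨g • u.1, (smul_ne_zero_iff_ne g).2 u.2⟩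
  one_smul u := Subtype.ext (one_smul _ u.1)
  mul_smul g h u := Subtype.ext (mul_smul g h u.1)

instance : SMulCommClass (Sp m F) Fˣ (NV m F) where
  smul_comm g a u := Subtype.ext (smul_comm g (a : F) (u : V m F))

lemma NV.coe_smul (g : Sp m F) (u : NV m F) : ((g • u : NV m F) : V m F) = g • (u : V m F) := rfl

lemma NV.coe_units_smul (a : Fˣ) (u : NV m F) :
    ((a • u : NV m F) : V m F) = (a : F) • (u : V m F) := rfl

lemma NV.units_smul_left_injective (u : NV m F) : Function.Injective fun a : Fˣ ↦ a • u :=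
  fun _ _ h ↦ Units.ext (smul_left_injective F u.2 (congrArg Subtype.val h))

lemma NV.exists_smul_eq (u w : NV m F) : ∃ g : Sp m F, g • u = w := by
  obtain ⟨g, hg⟩ := SpOrthogonal.exists_smul_eq u.2 w.2
  exact ⟨g, Subtype.ext hg⟩

lemma NV.mk'_eq_mk'_iff {u w : NV m F} :
    Projectivization.mk' F u = Projectivization.mk' F w ↔ ∃ a : Fˣ, a • w = u := by
  rw [Projectivization.mk'_eq_mk, Projectivization.mk'_eq_mk, Projectivization.mk_eq_mk_iff]
  exact exists_congr fun a ↦ (Subtype.ext_iff (a1 := a • w)).symm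

lemma NV.smul_mk' (g : Sp m F) (u : NV m F) :
    g • Projectivization.mk' F u = Projectivization.mk' F (g • u) :=
  Projectivization.smul_mk ..

lemma card_filter_mk'_eq [Fintype Fˣ] [Fintype (NV m F)] [DecidableEq (ℙ F (V m F))]
    (l : ℙ F (V m F)) :
    Finset.card {u : NV m F | Projectivization.mk' F u = l} = Fintype.card Fˣ := by
  classical
  induction l using Projectivization.ind with | h v hv
  rw [← Finset.card_univ, ← Finset.card_image_of_injective _ (NV.units_smul_left_injective ⟨v, hv⟩)]
  congr 1
  ext u
  rw [Finset.mem_filter_univ, ← Projectivization.mk'_eq_mk F (⟨v, hv⟩ : NV m F),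
    NV.mk'_eq_mk'_iff]
  simp

section PairInvariant

open scoped Classical in
/-- The invariant of a pair of nonzero vectors under `Sp m F`: their ratio if they are dependent,
and the value of the symplectic form otherwise. -/
def pairInvariant (p : NV m F × NV m F) : Fˣ ⊕ F :=
  if h : ∃ c : Fˣ, p.2 = c • p.1 then .inl h.choose else .inr (sympForm p.1.1 p.2.1)

lemma pairInvariant_smul_self (u : NV m F) (c : Fˣ) : pairInvariant (u, c • u) = .inl c := by
  have h : ∃ c' : Fˣ, c • u = c' • u := ⟨c, rfl⟩
  rw [pairInvariant, dif_pos h]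
  exact congrArg _ (u.units_smul_left_injective h.choose_spec).symm

lemma pairInvariant_of_not {u w : NV m F} (h : ¬ ∃ c : Fˣ, w = c • u) :
    pairInvariant (u, w) = .inr (sympForm u.1 w.1) :=
  dif_neg h

lemma NV.linearIndependent_of_not {u w : NV m F} (h : ¬ ∃ c : Fˣ, w = c • u) :
    LinearIndependent F ![u.1, w.1] := by
  rw [LinearIndependent.pair_iff' u.2]
  intro c hc
  refine h ⟨Units.mk0 c ?_, Subtype.ext hc.symm⟩
  rintro rfl
  exact w.2 (by rw [← hc, zero_smul])

lemma pairInvariant_units_smul (a b : Fˣ) (p : NV m F × NV m F) :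
    pairInvariant (a • p.1, b • p.2) =
      Sum.map (fun c : Fˣ ↦ c * b * a⁻¹) (fun c : F ↦ a * b * c) (pairInvariant p) := by
  obtain ⟨u, w⟩ := p
  by_cases h : ∃ c : Fˣ, w = c • u
  · obtain ⟨c, rfl⟩ := h
    have : b • c • u = (c * b * a⁻¹) • a • u := by
      rw [smul_smul, smul_smul, inv_mul_cancel_right, mul_comm]
    dsimp only
    rw [this, pairInvariant_smul_self, pairInvariant_smul_self, Sum.map_inl]
  · have h' : ¬ ∃ c : Fˣ, b • w = c • a • u := by
      rintro ⟨c, hc⟩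
      exact h ⟨b⁻¹ * c * a, by rw [mul_smul, mul_smul, ← hc, inv_smul_smul]⟩
    rw [pairInvariant_of_not h, pairInvariant_of_not h', Sum.map_inr, NV.coe_units_smul,
      NV.coe_units_smul, sympForm_smul_left, sympForm_smul_right, mul_assoc]

lemma pairInvariant_smul (g : Sp m F) (p : NV m F × NV m F) :
    pairInvariant (g • p) = pairInvariant p := by
  obtain ⟨u, w⟩ := p
  rw [Prod.smul_mk]
  by_cases h : ∃ c : Fˣ, w = c • u
  · obtain ⟨c, rfl⟩ := h
    rw [smul_comm, pairInvariant_smul_self, pairInvariant_smul_self]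
  · have h' : ¬ ∃ c : Fˣ, g • w = c • g • u := by
      rintro ⟨c, hc⟩
      rw [← smul_comm] at hc
      exact h ⟨c, smul_left_cancel g hc⟩
    rw [pairInvariant_of_not h, pairInvariant_of_not h', NV.coe_smul, NV.coe_smul,
      sympForm_smul_smul]

lemma pairInvariant_eq_iff (p p' : NV m F × NV m F) :
    pairInvariant p = pairInvariant p' ↔ p' ∈ MulAction.orbit (Sp m F) p := by
  refine ⟨fun hpp ↦ ?_, fun ⟨g, hg⟩ ↦ by rw [← hg, pairInvariant_smul]⟩
  obtain ⟨u, w⟩ := p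
  obtain ⟨u', w'⟩ := p'
  by_cases h : ∃ c : Fˣ, w = c • u <;> by_cases h' : ∃ c : Fˣ, w' = c • u'
  · obtain ⟨c, rfl⟩ := h
    obtain ⟨c', rfl⟩ := h'
    rw [pairInvariant_smul_self, pairInvariant_smul_self, Sum.inl.injEq] at hpp
    subst hpp
    obtain ⟨g, rfl⟩ := NV.exists_smul_eq u u'
    exact ⟨g, congrArg _ (smul_comm g c u)⟩
  · obtain ⟨c, rfl⟩ := h
    rw [pairInvariant_smul_self, pairInvariant_of_not h'] at hpp
    exact absurd hpp Sum.inl_ne_inr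
  · obtain ⟨c, rfl⟩ := h'
    rw [pairInvariant_smul_self, pairInvariant_of_not h] at hpp
    exact absurd hpp Sum.inr_ne_inl
  · rw [pairInvariant_of_not h, pairInvariant_of_not h', Sum.inr.injEq] at hpp
    obtain ⟨g, hg, hg'⟩ := exists_smul_pair_eq (NV.linearIndependent_of_not h)
      (NV.linearIndependent_of_not h') hpp
    exact ⟨g, Prod.ext (Subtype.ext hg) (Subtype.ext hg')⟩

lemma pairInvariant_surjective (hm : 2 ≤ m) :
    Function.Surjective (pairInvariant : NV m F × NV m F → Fˣ ⊕ F) := by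
  let i : Fin m := ⟨0, by omega⟩
  let j : Fin m := ⟨1, by omega⟩
  have hij : j ≠ i := by simp [i, j]
  let u : V m F := Pi.single (.inr i) 1
  have hu : u ≠ 0 := fun h ↦ by simpa [u] using congrFun h (.inr i)
  rintro (c | c)
  · exact ⟨(⟨u, hu⟩, c • ⟨u, hu⟩), pairInvariant_smul_self _ _⟩
  · let w : V m F := Pi.single (.inl i) c + Pi.single (.inr j) 1
    have hwj : w (.inr j) = 1 := by simp [w]
    have huj : u (.inr j) = 0 := by simp [u, hij]
    have hw : w ≠ 0 := fun h ↦ by simp [h] at hwj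
    have huw : sympForm u w = c := by
      rw [sympForm_apply, Finset.sum_eq_single i (fun k _ hk ↦ by simp [u, hk]) (by simp)]
      simp [u, w]
    refine ⟨(⟨u, hu⟩, ⟨w, hw⟩), ?_⟩
    rw [pairInvariant_of_not, huw]
    rintro ⟨a, ha⟩
    have := congrFun (congrArg Subtype.val ha) (.inr j)
    change w (.inr j) = a * u (.inr j) at this
    simp [hwj, huj] at this

end PairInvariant

end NonzeroVectors

section Theta

variable {m : ℕ} {F : Type*} [Field F]

/-- The number of nonzero vectors `u` with `g u = a u`. -/
def eigenCount (g : Sp m F) (a : Fˣ) : ℕ := Nat.card {u : NV m F // g • u = a • u}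

lemma eigenCount_inv (g : Sp m F) (a : Fˣ) : eigenCount g⁻¹ a⁻¹ = eigenCount g a := by
  refine Nat.card_congr (Equiv.subtypeEquivRight fun u ↦ ?_)
  rw [inv_smul_eq_iff, smul_comm, eq_inv_smul_iff, eq_comm]

lemma eigenCount_eq_card_filter [Fintype (NV m F)] [DecidableEq (NV m F)] (g : Sp m F) (a : Fˣ) :
    eigenCount g a = Finset.card {u : NV m F | g • u = a • u} := by
  rw [eigenCount, Nat.card_eq_fintype_card, Fintype.card_subtype]

lemma card_units_ne_zero (F : Type*) [Field F] [Finite F] : (Nat.card Fˣ : ℂ) ≠ 0 :=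
  Nat.cast_ne_zero.2 Nat.card_pos.ne'

variable [Fintype Fˣ]

/-- The characters `θ_η` into which the permutation character on nonzero vectors decomposes
according to the action of `Fˣ`. They are the characters induced from the linear characters of
`P / G_v ≅ Fˣ`, but the formula makes them independent of a choice of `v`. -/
def theta (m : ℕ) {F : Type*} [Field F] [Fintype Fˣ] (η : Fˣ →* ℂˣ) (g : Sp m F) : ℂ :=
  (Nat.card Fˣ : ℂ)⁻¹ * ∑ a, (η a : ℂ) * eigenCount g a

lemma theta_inv_apply (η : Fˣ →* ℂˣ) (g : Sp m F) : theta m η g⁻¹ = theta m η⁻¹ g := by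
  rw [theta, theta]
  congr 1
  refine Fintype.sum_equiv (Equiv.inv _) _ _ fun a ↦ ?_
  rw [Equiv.inv_apply, MonoidHom.inv_apply, map_inv, inv_inv, ← eigenCount_inv g, inv_inv]

lemma sum_characters_mul (η ξ : Fˣ →* ℂˣ) [DecidableEq F] :
    ∑ a, ∑ b, (η a : ℂ) * ξ b *
      ((if a = b then (Nat.card Fˣ : ℂ) else 0) +
        (1 + if a * b = 1 then (Nat.card Fˣ : ℂ) else 0)) =
      Nat.card Fˣ * ∑ a, ((η * ξ) a : ℂ) + ((∑ a, (η a : ℂ)) * ∑ b, (ξ b : ℂ) +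
        Nat.card Fˣ * ∑ a, ((η * ξ⁻¹) a : ℂ)) := by
  simp_rw [mul_add, Finset.sum_add_distrib, mul_one, Finset.sum_mul_sum, Finset.mul_sum,
    mul_eq_one_iff_inv_eq]
  simp [mul_comm]

variable [Fintype F]

lemma card_filter_sumMap_eq [DecidableEq F] (a b : Fˣ) :
    Finset.card {i : Fˣ ⊕ F |
      Sum.map (fun c : Fˣ ↦ c * b * a⁻¹) (fun c : F ↦ a * b * c) i = i} =
      (if a = b then Nat.card Fˣ else 0) + (1 + if a * b = 1 then Nat.card Fˣ else 0) := by
  have hinl (c : Fˣ) : c * b * a⁻¹ = c ↔ a = b := by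
    rw [mul_assoc, mul_eq_left, mul_inv_eq_one, eq_comm]
  have hinr (c : F) : (a : F) * b * c = c ↔ c = 0 ∨ a * b = 1 := by
    by_cases hc : c = 0
    · simp [hc]
    · rw [mul_eq_right₀ hc, Units.ext_iff]
      simp [hc]
  rw [Finset.card_filter, Fintype.sum_sum_type]
  simp only [Sum.map_inl, Sum.inl.injEq, Sum.map_inr, Sum.inr.injEq, hinl, hinr]
  congr 1
  · split_ifs <;> simp
  · split_ifs with h
    · simp [h, ← Nat.card_eq_fintype_card, Nat.card_eq_card_units_add_one, add_comm]
    · simp [h]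

lemma sum_eigenCount_mul_eigenCount (hm : 2 ≤ m) [DecidableEq F] (a b : Fˣ) :
    ∑ g : Sp m F, eigenCount g a * eigenCount g b = Nat.card (Sp m F) *
      ((if a = b then Nat.card Fˣ else 0) + (1 + if a * b = 1 then Nat.card Fˣ else 0)) := by
  rw [← card_filter_sumMap_eq, ← sum_card_smul_eq_twist (G := Sp m F) (pairInvariant_surjective hm)
    pairInvariant_eq_iff (σ := fun p ↦ (a • p.1, b • p.2)) (pairInvariant_units_smul a b)]
  refine Finset.sum_congr rfl fun g _ ↦ ?_
  rw [eigenCount_eq_card_filter, eigenCount_eq_card_filter, ← Finset.card_product,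
    ← Finset.filter_product]
  simp [Prod.ext_iff]

lemma sum_theta_mul_theta (hm : 2 ≤ m) (η ξ : Fˣ →* ℂˣ) :
    ∑ g : Sp m F, theta m η g * theta m ξ g = Nat.card (Sp m F) * ((Nat.card Fˣ : ℂ)⁻¹ ^ 2 *
      (Nat.card Fˣ * ∑ a, ((η * ξ) a : ℂ) + ((∑ a, (η a : ℂ)) * ∑ b, (ξ b : ℂ) +
        Nat.card Fˣ * ∑ a, ((η * ξ⁻¹) a : ℂ)))) := by
  classical
  have hmul (g : Sp m F) : theta m η g * theta m ξ g = (Nat.card Fˣ : ℂ)⁻¹ ^ 2 *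
      ∑ a, ∑ b, (η a : ℂ) * ξ b * (eigenCount g a * eigenCount g b : ℕ) := by
    rw [theta, theta, mul_mul_mul_comm, Finset.sum_mul_sum, ← sq]
    congr 1
    refine Finset.sum_congr rfl fun a _ ↦ Finset.sum_congr rfl fun b _ ↦ ?_
    push_cast
    ring
  have hcomm : ∑ g : Sp m F, ∑ a, ∑ b, (η a : ℂ) * ξ b * (eigenCount g a * eigenCount g b : ℕ) =
      ∑ a, ∑ b, (η a : ℂ) * ξ b * (∑ g : Sp m F, eigenCount g a * eigenCount g b : ℕ) := by
    rw [Finset.sum_comm]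
    refine Finset.sum_congr rfl fun a _ ↦ ?_
    rw [Finset.sum_comm]
    exact Finset.sum_congr rfl fun b _ ↦ by rw [Nat.cast_sum, Finset.mul_sum]
  simp_rw [hmul, ← Finset.mul_sum, hcomm, sum_eigenCount_mul_eigenCount hm]
  rw [← sum_characters_mul]
  push_cast
  simp_rw [mul_left_comm _ (Nat.card (Sp m F) : ℂ), ← Finset.mul_sum,
    mul_left_comm _ (Nat.card (Sp m F) : ℂ)]

theorem charInner_theta (hm : 2 ≤ m) [DecidableEq (Fˣ →* ℂˣ)] (η ξ : Fˣ →* ℂˣ) :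
    charInner (theta m η) (theta m ξ) = (if η = ξ then 1 else 0) +
      ((if η = 1 ∧ ξ = 1 then 1 else 0) + if η * ξ = 1 then 1 else 0) := by
  have hq := card_units_ne_zero F
  have hinv : ξ⁻¹ = 1 ↔ ξ = 1 := by simp [MonoidHom.ext_iff]
  have hdiv : η * ξ⁻¹ = 1 ↔ η = ξ := by simp [MonoidHom.ext_iff, mul_inv_eq_one]
  have hmul : η * ξ⁻¹⁻¹ = η * ξ := by ext a; simp
  simp_rw [charInner, theta_inv_apply]
  rw [sum_theta_mul_theta hm, inv_mul_cancel_left₀ (Nat.cast_ne_zero.2 Nat.card_pos.ne'), hmul,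
    sum_character, sum_character, sum_character, sum_character, ← Nat.card_eq_fintype_card]
  simp only [hdiv, hinv, ite_and]
  rw [mul_add, mul_add]
  congr 1
  · split_ifs
    · field_simp
    · simp
  · congr 1
    all_goals split_ifs <;> simp [field]

omit [Fintype F] in
lemma sum_eigenCount [Finite F] [Fintype (ℙ F (V m F))] [DecidableEq (ℙ F (V m F))] (g : Sp m F) :
    ∑ a, eigenCount g a = Nat.card Fˣ * Finset.card {l : ℙ F (V m F) | g • l = l} := by
  classical
  have := Fintype.ofFinite F
  let S : Finset (NV m F) := {u | g • Projectivization.mk' F u = Projectivization.mk' F u}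
  have hS : S = Finset.univ.biUnion fun a : Fˣ ↦ {u : NV m F | g • u = a • u} := by
    ext u
    rw [Finset.mem_filter_univ, NV.smul_mk', NV.mk'_eq_mk'_iff]
    simp [eq_comm]
  have hdisj : Set.PairwiseDisjoint ((Finset.univ : Finset Fˣ) : Set Fˣ)
      fun a : Fˣ ↦ ({u : NV m F | g • u = a • u} : Finset (NV m F)) := by
    refine fun a _ b _ hab ↦ Finset.disjoint_filter.2 fun u _ ha hb ↦ hab ?_
    exact u.units_smul_left_injective (ha.symm.trans hb)
  calc ∑ a, eigenCount g a
      = S.card := by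
        rw [hS, Finset.card_biUnion hdisj]
        exact Finset.sum_congr rfl fun a _ ↦ eigenCount_eq_card_filter g a
    _ = ∑ l : ℙ F (V m F) with g • l = l, Finset.card {u ∈ S | Projectivization.mk' F u = l} :=
        Finset.card_eq_sum_card_fiberwise fun u hu ↦
          (Finset.mem_filter_univ _).2 ((Finset.mem_filter_univ u).1 hu)
    _ = ∑ l : ℙ F (V m F) with g • l = l, Nat.card Fˣ := by
        refine Finset.sum_congr rfl fun l hl ↦ ?_
        rw [Nat.card_eq_fintype_card, ← card_filter_mk'_eq l, Finset.filter_filter]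
        congr 1
        refine Finset.filter_congr fun u _ ↦ and_iff_right_of_imp fun hu ↦ ?_
        rw [hu, (Finset.mem_filter.1 hl).2]
    _ = _ := by rw [Finset.sum_const, smul_eq_mul, mul_comm]

omit [Fintype F] in
lemma permChar_points_eq_theta [Finite F] :
    permChar (Sp m F) (ℙ F (V m F)) = theta m (1 : Fˣ →* ℂˣ) := by
  classical
  have := Fintype.ofFinite F
  have := Fintype.ofFinite (ℙ F (V m F))
  ext g
  rw [permChar_apply, theta, eq_inv_mul_iff_mul_eq₀ (card_units_ne_zero F), ← Nat.cast_mul,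
    ← sum_eigenCount g, Nat.cast_sum]
  simp

lemma permChar_vectors_eq_one_add_sum_theta :
    permChar (Sp m F) (V m F) = 1 + ∑ η : Fˣ →* ℂˣ, theta m η := by
  classical
  ext g
  have hsum : (∑ η : Fˣ →* ℂˣ, theta m η) g = eigenCount g 1 := by
    simp only [Finset.sum_apply, theta]
    rw [← Finset.mul_sum, Finset.sum_comm]
    simp_rw [← Finset.sum_mul, sum_characters, ite_mul, zero_mul]
    rw [Finset.sum_ite_eq' , if_pos (Finset.mem_univ _), ← Nat.card_eq_fintype_card,
      inv_mul_cancel_left₀ (card_units_ne_zero F)]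
  have hzero : ({v : V m F | g • v = v} : Finset (V m F)) =
      insert 0 (({u : NV m F | g • u = u} : Finset (NV m F)).map (.subtype _)) := by
    ext v
    by_cases hv : v = 0 <;> simp [hv, Subtype.ext_iff, NV.coe_smul]
  rw [Pi.add_apply, hsum, permChar_apply, Pi.one_apply, eigenCount_eq_card_filter, hzero,
    Finset.card_insert_of_notMem (by simp), Finset.card_map, Nat.cast_add_one, add_comm]
  simp

end Theta

section Parabolic

variable {m : ℕ} {F : Type*} [Field F] {v : V m F} {hv : v ≠ 0}

instance : MulAction.IsPretransitive (Sp m F) (NV m F) := ⟨NV.exists_smul_eq⟩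

lemma mem_parabolic_iff {g : Sp m F} : g ∈ parabolic v hv ↔ ∃ a : Fˣ, a • v = g • v := by
  rw [MulAction.mem_stabilizer_iff, Projectivization.smul_mk, Projectivization.mk_eq_mk_iff]

lemma exists_units_smul_eq (p : parabolic v hv) : ∃ a : Fˣ, a • v = (p : Sp m F) • v :=
  mem_parabolic_iff.1 p.2

/-- The eigenvalue on `⟨v⟩` of an element of the stabilizer `P` of `⟨v⟩`; it identifies `P / G_v`
with `Fˣ`. -/
def eigenvalue (v : V m F) (hv : v ≠ 0) : parabolic v hv →* Fˣ :=
  .mk' (fun p ↦ (exists_units_smul_eq p).choose) fun p r ↦ by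
    refine NV.units_smul_left_injective ⟨v, hv⟩ (Subtype.ext ?_)
    change (exists_units_smul_eq (p * r)).choose • v = _ • v
    rw [(exists_units_smul_eq (p * r)).choose_spec, mul_comm, mul_smul,
      (exists_units_smul_eq p).choose_spec, Subgroup.coe_mul, mul_smul]
    refine (congrArg _ (exists_units_smul_eq r).choose_spec.symm).trans ?_
    exact smul_comm (p : Sp m F) ((exists_units_smul_eq r).choose : F) v

lemma eigenvalue_smul (p : parabolic v hv) : eigenvalue v hv p • v = (p : Sp m F) • v :=
  (exists_units_smul_eq p).choose_spec

lemma eigenvalue_eq_iff {p : parabolic v hv} {a : Fˣ} :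
    eigenvalue v hv p = a ↔ (p : Sp m F) • v = a • v := by
  rw [← eigenvalue_smul]
  refine ⟨fun h ↦ by rw [h], fun h ↦ ?_⟩
  exact NV.units_smul_left_injective ⟨v, hv⟩ (Subtype.ext h)

lemma eigenvalue_surjective : Function.Surjective (eigenvalue v hv) := by
  intro a
  obtain ⟨g, hg⟩ := exists_smul_eq hv (a • (⟨v, hv⟩ : NV m F)).2
  exact ⟨⟨g, mem_parabolic_iff.2 ⟨a, hg.symm⟩⟩, eigenvalue_eq_iff.2 hg⟩

/-- Inflation of linear characters along `P → P / G_v ≅ Fˣ`. -/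
def inflation (v : V m F) (hv : v ≠ 0) : (Fˣ →* ℂˣ) ↪ (parabolic v hv →* ℂˣ) where
  toFun η := η.comp (eigenvalue v hv)
  inj' _ _ := (MonoidHom.cancel_right eigenvalue_surjective).1

lemma inflation_apply (η : Fˣ →* ℂˣ) (p : parabolic v hv) :
    inflation v hv η p = η (eigenvalue v hv p) := rfl

lemma isNontrivialModStabilizer_iff {ζ : parabolic v hv →* ℂˣ} :
    IsNontrivialModStabilizer ζ ↔ ∃ η : Fˣ →* ℂˣ, η ≠ 1 ∧ inflation v hv η = ζ := by
  have hone : inflation v hv 1 = 1 := MonoidHom.one_comp _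
  constructor
  · rintro ⟨hζ, hker⟩
    let η := (eigenvalue v hv).liftOfSurjective eigenvalue_surjective
      ⟨ζ, fun p hp ↦ hker p (by rw [← eigenvalue_smul, MonoidHom.mem_ker.1 hp, one_smul])⟩
    have hη : inflation v hv η = ζ := MonoidHom.liftOfRightInverse_comp ..
    exact ⟨η, fun h ↦ hζ (by rw [← hη, h, hone]), hη⟩
  · rintro ⟨η, hη, rfl⟩
    refine ⟨fun h ↦ hη ((inflation v hv).injective (h.trans hone.symm)), fun p hp ↦ ?_⟩
    rw [inflation_apply, eigenvalue_eq_iff.2 (hp.trans (one_smul _ v).symm), map_one]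

lemma conjChar_inflation [Finite F] (η : Fˣ →* ℂˣ) :
    conjChar (inflation v hv η) = inflation v hv η⁻¹ := by
  have := Fintype.ofFinite Fˣ
  ext p
  have hroot : η (eigenvalue v hv p) ∈ rootsOfUnity (Fintype.card Fˣ) ℂ := by
    rw [mem_rootsOfUnity, ← map_pow, pow_card_eq_one, map_one]
  simpa [conjChar, inflation_apply] using Complex.conj_rootsOfUnity hroot

lemma dite_eigenvalue_eq_sum [Fintype Fˣ] [DecidableEq F] (f : Fˣ → ℂ) (g : Sp m F)
    [Decidable (g ∈ parabolic v hv)] :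
    (if h : g ∈ parabolic v hv then f (eigenvalue v hv ⟨g, h⟩) else 0) =
      ∑ a, f a * if g • v = a • v then 1 else 0 := by
  split_ifs with h
  · have heig (a : Fˣ) : g • v = a • v ↔ eigenvalue v hv ⟨g, h⟩ = a :=
      (eigenvalue_eq_iff (p := ⟨g, h⟩)).symm
    simp only [heig, mul_ite, mul_one, mul_zero, Finset.sum_ite_eq, Finset.mem_univ, if_true]
  · refine (Finset.sum_eq_zero fun a _ ↦ ?_).symm
    rw [if_neg fun ha ↦ h (mem_parabolic_iff.2 ⟨a, ha.symm⟩), mul_zero]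

lemma sum_ite_smul_eq_smul [Fintype F] [DecidableEq F] (v : V m F) (hv : v ≠ 0) (g : Sp m F)
    (a : Fˣ) :
    (∑ x : Sp m F, if g • x • v = a • x • v then (1 : ℂ) else 0) =
      Nat.card (MulAction.stabilizer (Sp m F) (⟨v, hv⟩ : NV m F)) * eigenCount g a := by
  have hcount := card_filter_comp_smul (G := Sp m F) (⟨v, hv⟩ : NV m F) fun u ↦ g • u = a • u
  rw [← eigenCount_eq_card_filter] at hcount
  rw [← Nat.cast_mul, ← hcount, Finset.card_filter, Nat.cast_sum]
  refine Finset.sum_congr rfl fun x _ ↦ ?_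
  rw [Nat.cast_ite, Nat.cast_one, Nat.cast_zero]
  exact if_congr ⟨fun h ↦ Subtype.ext h, congrArg Subtype.val⟩ rfl rfl

lemma card_parabolic [Finite F] (v : V m F) (hv : v ≠ 0) : (Nat.card (parabolic v hv) : ℂ) =
    Nat.card (MulAction.stabilizer (Sp m F) (⟨v, hv⟩ : NV m F)) * Nat.card Fˣ := by
  classical
  have := Fintype.ofFinite F
  have hcount := card_filter_comp_smul (G := Sp m F) (⟨v, hv⟩ : NV m F) fun u ↦
    Projectivization.mk' F u = Projectivization.mk F v hv
  have hline := card_filter_mk'_eq (Projectivization.mk F v hv)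
  rw [Nat.card_eq_fintype_card (α := Fˣ), ← hline, ← Nat.cast_mul]
  refine congrArg Nat.cast (Eq.trans ?_ hcount)
  rw [Nat.card_eq_fintype_card, Fintype.card_subtype]
  rfl

theorem character_inducedRep_inflation [Finite F] [Fintype Fˣ] (v : V m F) (hv : v ≠ 0)
    (η : Fˣ →* ℂˣ) : (inducedRep (inflation v hv η)).character = theta m η := by
  classical
  have := Fintype.ofFinite F
  ext g
  have hconj (x : Sp m F) (a : Fˣ) : (x⁻¹ * g * x) • v = a • v ↔ g • x • v = a • x • v := by
    rw [mul_smul, mul_smul, inv_smul_eq_iff]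
    exact Eq.congr_right (smul_comm x (a : F) v)
  have hstab : (Nat.card (MulAction.stabilizer (Sp m F) (⟨v, hv⟩ : NV m F)) : ℂ) ≠ 0 :=
    Nat.cast_ne_zero.2 Nat.card_pos.ne'
  have hsum (a : Fˣ) : (∑ x : Sp m F, (η a : ℂ) * if g • x • v = a • x • v then 1 else 0) =
      Nat.card (MulAction.stabilizer (Sp m F) (⟨v, hv⟩ : NV m F)) * (η a * eigenCount g a) := by
    rw [← Finset.mul_sum, sum_ite_smul_eq_smul v hv, mul_left_comm]
  rw [character_inducedRep]
  refine (congrArg _ (Finset.sum_congr rfl fun x _ ↦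
    dite_eigenvalue_eq_sum (fun a ↦ (η a : ℂ)) (x⁻¹ * g * x))).trans ?_
  simp only [hconj]
  rw [Finset.sum_comm, Finset.sum_congr rfl fun a _ ↦ hsum a, ← Finset.mul_sum, card_parabolic,
    theta, mul_inv_rev, mul_assoc, inv_mul_cancel_left₀ hstab]

end Parabolic

section Transversals

/-- A set of representatives of the nontrivial elements of `A` up to inversion, when `A` has no
involutions. -/
structure IsInvTransversal {A : Type*} [Group A] (S : Finset A) : Prop where
  one_notMem : 1 ∉ S
  mem_iff : ∀ a, a ≠ 1 → (a ∈ S ↔ a⁻¹ ∉ S)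

lemma exists_isInvTransversal {A : Type*} [Group A] [Finite A] (hA : ∀ a : A, a = a⁻¹ → a = 1) :
    ∃ S : Finset A, IsInvTransversal S := by
  have := Fintype.ofFinite A
  let e := Fintype.equivFin A
  refine ⟨Finset.univ.filter fun a ↦ e a < e a⁻¹, by simp, fun a ha ↦ ?_⟩
  have hne : e a ≠ e a⁻¹ := fun h ↦ ha (hA a (e.injective h))
  simp only [Finset.mem_filter_univ, inv_inv, not_lt]
  exact ⟨le_of_lt, fun h ↦ lt_of_le_of_ne h hne⟩

namespace IsInvTransversal

variable {A : Type*} [Group A] {S : Finset A}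

lemma ne_one (hS : IsInvTransversal S) {a : A} (ha : a ∈ S) : a ≠ 1 :=
  ne_of_mem_of_not_mem ha hS.one_notMem

variable [Fintype A]

lemma sum_eq {M : Type*} [AddCommMonoid M] (hS : IsInvTransversal S) (f : A → M) :
    ∑ a, f a = f 1 + (∑ a ∈ S, f a + ∑ a ∈ S, f a⁻¹) := by
  classical
  have hcompl : (Finset.univ.erase 1 : Finset A) \ S = S.map (Equiv.inv A).toEmbedding := by
    ext a
    rw [Finset.mem_map_equiv, Finset.mem_sdiff, Finset.mem_erase]
    change _ ↔ a⁻¹ ∈ S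
    by_cases ha : a = 1
    · simp [ha, hS.one_notMem]
    · simp [ha, hS.mem_iff a ha]
  have hsub : S ⊆ Finset.univ.erase 1 := fun a ha ↦ by simpa using hS.ne_one ha
  rw [← Finset.add_sum_erase Finset.univ f (Finset.mem_univ 1), ← Finset.sum_sdiff hsub, hcompl,
    Finset.sum_map, add_comm (∑ a ∈ S, _)]
  rfl

lemma card_eq (hS : IsInvTransversal S) : Fintype.card A = 1 + (S.card + S.card) := by
  simpa using hS.sum_eq fun _ ↦ (1 : ℕ)

end IsInvTransversal

lemma existsUnique_mem_pair_iff {α : Type*} {s : Set α} {x y : α} (hxy : x ≠ y) :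
    (∃! z, z ∈ s ∧ (z = x ∨ z = y)) ↔ (x ∈ s ↔ y ∉ s) := by
  constructor
  · rintro ⟨z, ⟨hz, h⟩, huniq⟩
    refine ⟨fun hx hy ↦ hxy ?_, fun hy ↦ ?_⟩
    · rw [huniq x ⟨hx, .inl rfl⟩, huniq y ⟨hy, .inr rfl⟩]
    · exact h.resolve_right (fun hzy ↦ hy (hzy ▸ hz)) ▸ hz
  · intro h
    by_cases hx : x ∈ s
    · refine ⟨x, ⟨hx, .inl rfl⟩, ?_⟩
      rintro z ⟨hz, rfl | rfl⟩
      exacts [rfl, absurd hz (h.1 hx)]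
    · refine ⟨y, ⟨not_not.1 (mt h.2 hx), .inr rfl⟩, ?_⟩
      rintro z ⟨hz, rfl | rfl⟩
      exacts [absurd hz hx, rfl]

variable {m : ℕ} {F : Type*} [Field F] [Finite F] [CharP F 2] {v : V m F} {hv : v ≠ 0}

lemma characters_sq_bijective : Function.Bijective fun η : Fˣ →* ℂˣ ↦ η ^ 2 := by
  rw [← Finite.injective_iff_bijective]
  intro η ξ h
  ext a
  obtain ⟨b, hb⟩ := surjective_frobenius F 2 a
  have hb0 : b ≠ 0 := by
    rintro rfl
    exact a.ne_zero (by rw [← hb, map_zero])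
  obtain rfl : a = Units.mk0 b hb0 ^ 2 := Units.ext hb.symm
  rw [map_pow, map_pow]
  exact congrArg Units.val (DFunLike.congr_fun h (Units.mk0 b hb0))

lemma eq_one_of_character_eq_inv {η : Fˣ →* ℂˣ} (h : η = η⁻¹) : η = 1 :=
  characters_sq_bijective.1 <| by
    dsimp only
    rw [one_pow (M := Fˣ →* ℂˣ) 2, sq]
    nth_rw 2 [h]
    exact mul_inv_cancel η

lemma isConjRepresentatives_map_inflation_iff {T : Finset (Fˣ →* ℂˣ)} :
    IsConjRepresentatives (T.map (inflation v hv)) ↔ IsInvTransversal T := by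
  have hpair (η : Fˣ →* ℂˣ) (hη : η ≠ 1) :
      (∃! ξ, ξ ∈ T.map (inflation v hv) ∧
        (ξ = inflation v hv η ∨ ξ = conjChar (inflation v hv η))) ↔ (η ∈ T ↔ η⁻¹ ∉ T) := by
    rw [conjChar_inflation]
    exact (existsUnique_mem_pair_iff (s := ↑(T.map (inflation v hv))) fun h ↦
      hη (eq_one_of_character_eq_inv ((inflation v hv).injective h))).trans <| by
        rw [Finset.mem_coe, Finset.mem_coe, Finset.mem_map', Finset.mem_map']
  constructor
  · rintro ⟨hS, hT⟩
    refine ⟨fun h ↦ ?_, fun η hη ↦ (hpair η hη).1 (hT _ ?_)⟩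
    on_goal 2 => exact isNontrivialModStabilizer_iff.2 ⟨η, hη, rfl⟩
    obtain ⟨η, hη, heq⟩ := isNontrivialModStabilizer_iff.1 (hS _ (Finset.mem_map_of_mem _ h))
    exact hη ((inflation v hv).injective heq)
  · intro hT
    refine ⟨fun ζ hζ ↦ ?_, fun ζ hζ ↦ ?_⟩
    · obtain ⟨η, hη, rfl⟩ := Finset.mem_map.1 hζ
      exact isNontrivialModStabilizer_iff.2 ⟨η, hT.ne_one hη, rfl⟩
    · obtain ⟨η, hη, rfl⟩ := isNontrivialModStabilizer_iff.1 hζ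
      exact (hpair η hη).2 (hT.mem_iff η hη)

lemma IsConjRepresentatives.exists_map_inflation_eq {S : Finset (parabolic v hv →* ℂˣ)}
    (hS : IsConjRepresentatives S) :
    ∃ T : Finset (Fˣ →* ℂˣ), IsInvTransversal T ∧ T.map (inflation v hv) = S := by
  obtain ⟨T, -, rfl⟩ : ∃ T : Finset (Fˣ →* ℂˣ), T ⊆ Finset.univ ∧ S = T.map (inflation v hv) := by
    refine Finset.subset_map_iff.1 fun ζ hζ ↦ ?_
    obtain ⟨η, -, rfl⟩ := isNontrivialModStabilizer_iff.1 (hS.1 ζ hζ)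
    exact Finset.mem_map_of_mem _ (Finset.mem_univ η)
  exact ⟨T, isConjRepresentatives_map_inflation_iff.1 hS, rfl⟩

lemma exists_isConjRepresentatives (v : V m F) (hv : v ≠ 0) :
    ∃ S : Finset (parabolic v hv →* ℂˣ), IsConjRepresentatives S := by
  obtain ⟨T, hT⟩ := exists_isInvTransversal (A := Fˣ →* ℂˣ) fun _ ↦ eq_one_of_character_eq_inv
  exact ⟨T.map (inflation v hv), isConjRepresentatives_map_inflation_iff.2 hT⟩

end Transversals

section OrthogonalCosets

variable {m : ℕ} {F : Type*} [Field F] {v : V m F}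

namespace Forms

lemma exists_map_smul_ne_zero (Q : Forms m F) (hv : v ≠ 0) : ∃ k : Sp m F, Q.1 (k • v) ≠ 0 := by
  by_contra! h
  have hQ (u : V m F) : Q.1 u = 0 := by
    rcases eq_or_ne u 0 with rfl | hu
    · exact QuadraticMap.map_zero _
    · obtain ⟨k, rfl⟩ := exists_smul_eq hv hu
      exact h k
  obtain ⟨y, hy⟩ := exists_sympForm_ne_zero hv
  exact hy (by simpa only [hQ, zero_add] using (Q.map_add v y).symm)

lemma nontrivial_orbits_cosets_prod_points (Q : Forms m F)
    (hQ : ∃ W, IsTotallySingular Q.1 W ∧ 0 < Module.finrank F W) :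
    Nontrivial (MulAction.orbitRel.Quotient (Sp m F)
      ((Sp m F ⧸ orthogonalSubgroup Q.1) × ℙ F (V m F))) := by
  obtain ⟨W, hW, hpos⟩ := hQ
  rw [Module.finrank_pos_iff, Submodule.nontrivial_iff_ne_bot] at hpos
  obtain ⟨u, huW, hu⟩ := Submodule.exists_mem_ne_zero_of_ne_bot hpos
  obtain ⟨k, hk⟩ := Q.exists_map_smul_ne_zero hu
  have hku : k • u ≠ 0 := (smul_ne_zero_iff_ne k).2 hu
  let o : Sp m F ⧸ orthogonalSubgroup Q.1 := (1 : Sp m F)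
  refine ⟨Quotient.mk'' (o, .mk F u hu), Quotient.mk'' (o, .mk F (k • u) hku), fun h ↦ hk ?_⟩
  obtain ⟨g, hg⟩ := Quotient.eq''.1 h
  obtain ⟨hgo, hgu⟩ := Prod.mk_inj.1 hg
  have hgQ : g ∈ orthogonalSubgroup Q.1 := by
    rwa [← MulAction.stabilizer_quotient (orthogonalSubgroup Q.1), MulAction.mem_stabilizer_iff]
  obtain ⟨a, ha : a • u = g • k • u⟩ := (Projectivization.mk_eq_mk_iff' ..).1 hgu
  rw [← hgQ, ← ha, QuadraticMap.map_smul, hW u huW, smul_zero]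

variable [Fintype F]

lemma charInner_cosets_one (Q : Forms m F) :
    charInner (permChar (Sp m F) (Sp m F ⧸ orthogonalSubgroup Q.1)) 1 = 1 := by
  have hsub := (MulAction.pretransitive_iff_subsingleton_quotient (Sp m F)
    (Sp m F ⧸ orthogonalSubgroup Q.1)).1 inferInstance
  have hne : Nonempty (MulAction.orbitRel.Quotient (Sp m F) (Sp m F ⧸ orthogonalSubgroup Q.1)) :=
    ⟨Quotient.mk'' ((1 : Sp m F) : Sp m F ⧸ orthogonalSubgroup Q.1)⟩
  rw [charInner_permChar_one, Nat.card_eq_one_iff_unique.2 ⟨hsub, hne⟩, Nat.cast_one]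

/-- The witness is the vector `∑ c, f (R_c v) • c` of the permutation module on the cosets `c`,
where `R_c` is the form attached to `c` and `f` is the multiplicative character of `F` with
`f ^ 2 = η`: if `p v = a v`, then `R_c (p v) = a ^ 2 * R_c v`. -/
lemma charInner_cosets_theta_ne_zero [Fintype Fˣ] [CharP F 2] (Q : Forms m F) (hv : v ≠ 0)
    (η : Fˣ →* ℂˣ) :
    charInner (permChar (Sp m F) (Sp m F ⧸ orthogonalSubgroup Q.1)) (theta m η) ≠ 0 := by
  obtain ⟨ξ, rfl⟩ := characters_sq_bijective.2 η
  let f := MulChar.ofUnitHom ξ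
  let y : MonoidAlgebra ℂ (Sp m F ⧸ orthogonalSubgroup Q.1) :=
    .ofCoeff (Finsupp.equivFunOnFinite.symm fun c ↦ f ((Q.cosetsEquivOrbit c).1.1 v))
  have hy (c) : y.coeff c = f ((Q.cosetsEquivOrbit c).1.1 v) := rfl
  rw [← character_inducedRep_inflation v hv]
  refine charInner_inducedRep_ne_zero (y := y) (fun p ↦ ?_) fun hy0 ↦ ?_
  · refine MonoidAlgebra.ext (Finsupp.ext fun c ↦ ?_)
    have hc : (Q.cosetsEquivOrbit ((p : Sp m F)⁻¹ • c)).1.1 v =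
        (eigenvalue v hv p : F) ^ 2 * (Q.cosetsEquivOrbit c).1.1 v := by
      rw [cosetsEquivOrbit_smul, MulAction.orbit.coe_smul, smul_apply, inv_inv, ← eigenvalue_smul,
        Units.smul_def, QuadraticMap.map_smul, smul_eq_mul, sq]
    rw [Representation.coeff_ofMulAction, hy, hc, map_mul, map_pow, MulChar.ofUnitHom_coe,
      MonoidAlgebra.coeff_smul, Finsupp.smul_apply, hy, inflation_apply]
    rfl
  · obtain ⟨k, hk⟩ := Q.exists_map_smul_ne_zero hv
    have hfk : f (Q.1 (k • v)) = 0 := by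
      have hyk := hy (k⁻¹ : Sp m F)
      rw [hy0, cosetsEquivOrbit_mk, smul_apply, inv_inv] at hyk
      exact hyk.symm
    exact (hk.isUnit.map f).ne_zero hfk

end Forms

end OrthogonalCosets

section Decomposition

open Representation

section

variable {G : Type*} [Group G]

lemma charInner_one_one [Fintype G] : charInner (1 : G → ℂ) 1 = 1 := by
  simp [charInner]

lemma isIrreducibleCharacter_one [Finite G] : IsIrreducibleCharacter (1 : G → ℂ) := by
  have := Fintype.ofFinite G
  have hchar : (trivial ℂ G ℂ).character = 1 := by
    ext g
    simp [character]
  rw [← hchar]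
  refine isIrreducibleCharacter_of_isIrreducible (isIrreducible_of_charInner_eq_one ?_)
  rw [hchar, charInner_one_one]

end

lemma constituents_eq_of_add_eq {α : Type*} {a b c : α} {K T M N : Multiset α}
    (hK : K.card = 2) (hM : c ::ₘ a ::ₘ T ≤ M) (hN : c ::ₘ b ::ₘ T ≤ N)
    (h : M + N = (c ::ₘ c ::ₘ K) + (T + T)) :
    K = {a, b} ∧ M = c ::ₘ a ::ₘ T ∧ N = c ::ₘ b ::ₘ T := by
  obtain ⟨hM', hN'⟩ := (add_eq_add_iff_eq_and_eq hM hN).1 (Multiset.eq_of_le_of_card_le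
    (add_le_add hM hN) (by simp [h, hK]; omega))
  refine ⟨?_, hM'.symm, hN'.symm⟩
  have : (c ::ₘ c ::ₘ (T + T)) + K = (c ::ₘ c ::ₘ (T + T)) + {a, b} := by
    simpa [← hM', ← hN', ← Multiset.singleton_add, add_assoc, add_comm, add_left_comm] using h.symm
  exact add_left_cancel this

variable {m : ℕ} {F : Type*} [Field F]

lemma exists_ne_zero_vector (hm : 1 ≤ m) : ∃ v : V m F, v ≠ 0 :=
  ⟨Pi.single (.inl ⟨0, hm⟩) 1, fun h ↦ by simpa using congrFun h (.inl ⟨0, hm⟩)⟩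

theorem isIrreducible_inducedRep_inflation [Finite F] [CharP F 2] (hm : 2 ≤ m) {η : Fˣ →* ℂˣ}
    (hη : η ≠ 1) (v : V m F) (hv : v ≠ 0) : (inducedRep (inflation v hv η)).IsIrreducible := by
  classical
  have := Fintype.ofFinite F
  refine isIrreducible_of_charInner_eq_one ?_
  rw [character_inducedRep_inflation, charInner_theta hm, if_pos rfl, if_neg fun h ↦ hη h.1,
    if_neg fun h ↦ hη (eq_one_of_character_eq_inv ((mul_eq_one_iff_eq_inv (G := Fˣ →* ℂˣ)).1 h)),
    add_zero, add_zero]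

section

variable [Finite F] [Fintype Fˣ]

lemma exists_isConstituents_theta_one (hm : 2 ≤ m) : ∃ K : Multiset (Sp m F → ℂ), K.card = 2 ∧
    (1 ::ₘ K).Nodup ∧ IsConstituents (1 ::ₘ K) (theta m (1 : Fˣ →* ℂˣ)) := by
  classical
  have := Fintype.ofFinite F
  obtain ⟨N, hN⟩ := exists_isConstituents (permModule (Sp m F) (ℙ F (V m F)))
  have hone : 1 ∈ N := by
    obtain ⟨v, hv⟩ := exists_ne_zero_vector (F := F) (one_le_two.trans hm)
    have : Nonempty (MulAction.orbitRel.Quotient (Sp m F) (ℙ F (V m F))) :=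
      ⟨Quotient.mk'' (.mk F v hv)⟩
    refine hN.mem_of_charInner_ne_zero isIrreducibleCharacter_one ?_
    rw [charInner_permChar_one, Nat.cast_ne_zero]
    exact Nat.card_pos.ne'
  obtain ⟨K, rfl⟩ := Multiset.exists_cons_of_mem hone
  rw [← permChar, permChar_points_eq_theta] at hN
  obtain ⟨hnodup, hcard⟩ := hN.nodup_and_card_eq (n := 3) (by norm_num) (by
    rw [charInner_theta hm, if_pos rfl, if_pos ⟨rfl, rfl⟩, if_pos (one_mul (1 : Fˣ →* ℂˣ))]
    norm_num)
  exact ⟨K, by rwa [Multiset.card_cons, Nat.succ_inj] at hcard, hnodup, hN⟩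

lemma Forms.exists_mem_of_isConstituents_theta_one {Q : Forms m F} {K M : Multiset (Sp m F → ℂ)}
    (hQ : ∃ W, IsTotallySingular Q.1 W ∧ 0 < Module.finrank F W)
    (hK : IsConstituents (1 ::ₘ K) (theta m (1 : Fˣ →* ℂˣ)))
    (hM : IsConstituents M (permChar (Sp m F) (Sp m F ⧸ orthogonalSubgroup Q.1))) :
    ∃ χ ∈ K, χ ∈ M := by
  classical
  have := Fintype.ofFinite F
  by_contra! hKM
  have := Q.nontrivial_orbits_cosets_prod_points hQ
  have hnorm := hM.charInner_eq_sum_count hK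
  have hone := hM.charInner_eq_count isIrreducibleCharacter_one
  rw [Q.charInner_cosets_one] at hone
  rw [← permChar_points_eq_theta, charInner_permChar, Nat.cast_inj, Multiset.map_cons,
    Multiset.map_congr rfl fun χ hχ ↦ Multiset.count_eq_zero.2 (hKM χ hχ), Multiset.sum_cons,
    ← Nat.cast_injective (R := ℂ) (Nat.cast_one.trans hone)] at hnorm
  refine (Finite.one_lt_card_iff_nontrivial.2 this).ne' ?_
  simpa using hnorm

variable [CharP F 2]

lemma isIrreducibleCharacter_theta (hm : 2 ≤ m) {η : Fˣ →* ℂˣ} (hη : η ≠ 1) :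
    IsIrreducibleCharacter (theta m η) := by
  obtain ⟨v, hv⟩ := exists_ne_zero_vector (F := F) (one_le_two.trans hm)
  rw [← character_inducedRep_inflation v hv]
  exact isIrreducibleCharacter_of_isIrreducible (isIrreducible_inducedRep_inflation hm hη v hv)

lemma theta_eq_iff (hm : 2 ≤ m) {η ξ : Fˣ →* ℂˣ} (hη : η ≠ 1) (hξ : ξ ≠ 1) :
    theta m η = theta m ξ ↔ η = ξ ∨ η = ξ⁻¹ := by
  classical
  have := Fintype.ofFinite F
  have h := charInner_irreducible (isIrreducibleCharacter_theta hm hη)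
    (isIrreducibleCharacter_theta hm hξ)
  rw [charInner_theta hm, if_neg (c := η = 1 ∧ ξ = 1) fun h ↦ hη h.1, zero_add] at h
  have hmul : η * ξ = 1 ↔ η = ξ⁻¹ := mul_eq_one_iff_eq_inv (G := Fˣ →* ℂˣ)
  rw [← hmul]
  split_ifs at h <;> grind

lemma theta_inv (hm : 2 ≤ m) (η : Fˣ →* ℂˣ) : theta m η⁻¹ = theta m η := by
  rcases eq_or_ne η 1 with rfl | hη
  · exact congrArg (theta m) (inv_one (G := Fˣ →* ℂˣ))
  · exact (theta_eq_iff hm (inv_ne_one (α := Fˣ →* ℂˣ).2 hη) hη).2 (.inr rfl)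

lemma permChar_vectors_eq_of_isInvTransversal (hm : 2 ≤ m) {S : Finset (Fˣ →* ℂˣ)}
    (hS : IsInvTransversal S) : permChar (Sp m F) (V m F) =
      1 + theta m (1 : Fˣ →* ℂˣ) + (∑ η ∈ S, theta m η + ∑ η ∈ S, theta m η) := by
  have := Fintype.ofFinite F
  simp only [permChar_vectors_eq_one_add_sum_theta, hS.sum_eq, theta_inv hm, add_assoc]

namespace IsInvTransversal

variable {S : Finset (Fˣ →* ℂˣ)}

lemma isConstituents_theta (hm : 2 ≤ m) (hS : IsInvTransversal S) :
    IsConstituents (S.val.map (theta m)) (∑ η ∈ S, theta m η) where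
  isIrreducibleCharacter χ hχ := by
    obtain ⟨η, hη, rfl⟩ := Multiset.mem_map.1 hχ
    exact isIrreducibleCharacter_theta hm (hS.ne_one hη)
  sum_eq := rfl

lemma injOn_theta (hm : 2 ≤ m) (hS : IsInvTransversal S) :
    Set.InjOn (theta m) (S : Set (Fˣ →* ℂˣ)) := by
  intro η hη ξ hξ h
  refine ((theta_eq_iff hm (hS.ne_one hη) (hS.ne_one hξ)).1 h).resolve_right ?_
  rintro rfl
  exact (hS.mem_iff ξ (hS.ne_one hξ)).1 hξ hη

lemma nodup_constituents (hm : 2 ≤ m) (hS : IsInvTransversal S) {N : Multiset (Sp m F → ℂ)}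
    (hnodup : N.Nodup) (hN : IsConstituents N (theta m (1 : Fˣ →* ℂˣ))) :
    (N + S.val.map (theta m)).Nodup := by
  classical
  have := Fintype.ofFinite F
  refine Multiset.nodup_add.2 ⟨hnodup, S.nodup.map_on fun _ h _ h' ↦ hS.injOn_theta hm h h',
    Multiset.disjoint_right.2 fun {χ} hχ ↦ ?_⟩
  obtain ⟨η, hη, rfl⟩ := Multiset.mem_map.1 hχ
  have hη1 := hS.ne_one hη
  have hcount := hN.charInner_eq_count (isIrreducibleCharacter_theta hm hη1)
  rw [charInner_theta hm, if_neg hη1.symm, if_neg fun h ↦ hη1 h.2,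
    if_neg (c := 1 * η = 1) fun h ↦ hη1 ((one_mul η).symm.trans h), add_zero, add_zero] at hcount
  exact Multiset.count_eq_zero.1 (Nat.cast_eq_zero.1 hcount.symm)

lemma cons_cons_le_constituents (hm : 2 ≤ m) (hS : IsInvTransversal S)
    {K M : Multiset (Sp m F → ℂ)} {Q : Forms m F} {χ : Sp m F → ℂ} (hnodup : (1 ::ₘ K).Nodup)
    (hK : IsConstituents (1 ::ₘ K) (theta m (1 : Fˣ →* ℂˣ)))
    (hM : IsConstituents M (permChar (Sp m F) (Sp m F ⧸ orthogonalSubgroup Q.1)))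
    (hχK : χ ∈ K) (hχM : χ ∈ M) : 1 ::ₘ χ ::ₘ S.val.map (theta m) ≤ M := by
  have := Fintype.ofFinite F
  have hsub : 1 ::ₘ χ ::ₘ S.val.map (theta m) ≤ (1 ::ₘ K) + S.val.map (theta m) := by
    rw [Multiset.cons_add, ← Multiset.singleton_add χ]
    exact Multiset.cons_le_cons _ (add_le_add_left (Multiset.singleton_le.2 hχK) _)
  rw [Multiset.le_iff_subset (Multiset.nodup_of_le hsub (hS.nodup_constituents hm hnodup hK))]
  obtain ⟨v, hv⟩ := exists_ne_zero_vector (F := F) (one_le_two.trans hm)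
  refine Multiset.cons_subset.2 ⟨?_, Multiset.cons_subset.2 ⟨hχM, fun ψ hψ ↦ ?_⟩⟩
  · refine hM.mem_of_charInner_ne_zero isIrreducibleCharacter_one ?_
    rw [Q.charInner_cosets_one]
    exact one_ne_zero
  · obtain ⟨η, -, rfl⟩ := Multiset.mem_map.1 hψ
    exact hM.mem_of_charInner_ne_zero ((hS.isConstituents_theta hm).isIrreducibleCharacter _ hψ)
      (Q.charInner_cosets_theta_ne_zero hv η)

end IsInvTransversal

theorem exists_decomposition (hm : 2 ≤ m) {Qp Qm : Forms m F} (hp : IsPlusType Qp.1)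
    (hmi : IsMinusType Qm.1) : ∃ χp χm : Sp m F → ℂ,
      IsIrreducibleCharacter χp ∧ IsIrreducibleCharacter χm ∧ χp ≠ 1 ∧ χm ≠ 1 ∧ χp ≠ χm ∧
      permChar (Sp m F) (ℙ F (V m F)) = 1 + χp + χm ∧
      ∀ S : Finset (Fˣ →* ℂˣ), IsInvTransversal S →
        permChar (Sp m F) (Sp m F ⧸ orthogonalSubgroup Qp.1) = 1 + χp + ∑ η ∈ S, theta m η ∧
        permChar (Sp m F) (Sp m F ⧸ orthogonalSubgroup Qm.1) = 1 + χm + ∑ η ∈ S, theta m η := by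
  have := Fintype.ofFinite F
  obtain ⟨K, hcard, hnodup, hK⟩ := exists_isConstituents_theta_one (F := F) hm
  obtain ⟨M, hM⟩ := exists_isConstituents (permModule (Sp m F) (Sp m F ⧸ orthogonalSubgroup Qp.1))
  obtain ⟨N, hN⟩ := exists_isConstituents (permModule (Sp m F) (Sp m F ⧸ orthogonalSubgroup Qm.1))
  obtain ⟨χp, hpK, hpM⟩ := Qp.exists_mem_of_isConstituents_theta_one
    (hp.exists_singular.imp fun W hW ↦ ⟨hW.1, by omega⟩) hK hM
  obtain ⟨χm, hmK, hmN⟩ := Qm.exists_mem_of_isConstituents_theta_one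
    (hmi.exists_singular.imp fun W hW ↦ ⟨hW.1, by omega⟩) hK hN
  have hsum := permChar_vectors_eq_add (Forms.notMem_orbit_of_isPlusType_of_isMinusType hp hmi)
  have key (S : Finset (Fˣ →* ℂˣ)) (hS : IsInvTransversal S) := by
    have hT := hS.isConstituents_theta hm
    have hV := (isIrreducibleCharacter_one.isConstituents.add hK).add (hT.add hT)
    rw [← permChar_vectors_eq_of_isInvTransversal hm hS, hsum] at hV
    exact constituents_eq_of_add_eq hcard
      (hS.cons_cons_le_constituents hm hnodup hK hM hpK hpM)
      (hS.cons_cons_le_constituents hm hnodup hK hN hmK hmN) ((hM.add hN).unique hV)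
  obtain ⟨S, hS⟩ := exists_isInvTransversal (A := Fˣ →* ℂˣ) fun _ ↦ eq_one_of_character_eq_inv
  obtain rfl := (key S hS).1
  obtain ⟨⟨hp1, hm1⟩, hpm⟩ : (χp ≠ 1 ∧ χm ≠ 1) ∧ χp ≠ χm := by
    simpa [eq_comm] using hnodup
  refine ⟨χp, χm, hM.isIrreducibleCharacter _ hpM, hN.isIrreducibleCharacter _ hmN, hp1, hm1, hpm,
    ?_, fun S hS ↦ ⟨?_, ?_⟩⟩
  · rw [permChar_points_eq_theta, ← hK.sum_eq, Multiset.sum_cons, Multiset.sum_pair, add_assoc]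
  · rw [permChar, ← hM.sum_eq, (key S hS).2.1, Multiset.sum_cons, Multiset.sum_cons, add_assoc]
    rfl
  · rw [permChar, ← hN.sum_eq, (key S hS).2.2, Multiset.sum_cons, Multiset.sum_cons, add_assoc]
    rfl

end

namespace IsConjRepresentatives

variable [CharP F 2] {v : V m F} {hv : v ≠ 0} {S : Finset (parabolic v hv →* ℂˣ)}

lemma card_eq [Fintype F] (hS : IsConjRepresentatives S) : S.card = Fintype.card F / 2 - 1 := by
  classical
  obtain ⟨T, hT, rfl⟩ := hS.exists_map_inflation_eq
  have hcard := hT.card_eq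
  rw [card_characters] at hcard
  rw [Finset.card_map, Fintype.card_eq_card_units_add_one, hcard]
  omega

lemma isIrreducible_inducedRep [Finite F] (hm : 2 ≤ m) (hS : IsConjRepresentatives S) :
    ∀ ζ ∈ S, (inducedRep ζ).IsIrreducible := by
  intro ζ hζ
  obtain ⟨η, hη, rfl⟩ := isNontrivialModStabilizer_iff.1 (hS.1 ζ hζ)
  exact isIrreducible_inducedRep_inflation hm hη v hv

lemma injOn_character_inducedRep [Finite F] (hm : 2 ≤ m) (hS : IsConjRepresentatives S) :
    Set.InjOn (fun ζ : parabolic v hv →* ℂˣ ↦ (inducedRep ζ).character) (S : Set _) := by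
  classical
  have := Fintype.ofFinite F
  obtain ⟨T, hT, rfl⟩ := hS.exists_map_inflation_eq
  rw [Finset.coe_map]
  rintro _ ⟨η, hη, rfl⟩ _ ⟨ξ, hξ, rfl⟩ h
  simp only [character_inducedRep_inflation] at h
  exact congrArg _ (hT.injOn_theta hm hη hξ h)

end IsConjRepresentatives

end Decomposition

end SpOrthogonal

end

theorem theorem1 (F : Type*) [Field F] [Fintype F] [CharP F 2] (m : ℕ) (hm : 1 ≤ m)
    (Qp Qm : QuadraticForm F (SpOrthogonal.V m F))
    (hQp : SpOrthogonal.IsPlusType Qp) (hQm : SpOrthogonal.IsMinusType Qm) :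
    -- `ℂV ≅ ℂΩ⁺ ⊕ ℂΩ⁻`
    Nonempty ((SpOrthogonal.permModule (SpOrthogonal.Sp m F) (SpOrthogonal.V m F)).Equiv
      ((SpOrthogonal.permModule (SpOrthogonal.Sp m F)
          (SpOrthogonal.Sp m F ⧸ SpOrthogonal.orthogonalSubgroup Qp)).prod
        (SpOrthogonal.permModule (SpOrthogonal.Sp m F)
          (SpOrthogonal.Sp m F ⧸ SpOrthogonal.orthogonalSubgroup Qm)))) ∧
    -- `π = π⁺ + π⁻`
    SpOrthogonal.permChar (SpOrthogonal.Sp m F) (SpOrthogonal.V m F) =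
      SpOrthogonal.permChar (SpOrthogonal.Sp m F)
          (SpOrthogonal.Sp m F ⧸ SpOrthogonal.orthogonalSubgroup Qp) +
        SpOrthogonal.permChar (SpOrthogonal.Sp m F)
          (SpOrthogonal.Sp m F ⧸ SpOrthogonal.orthogonalSubgroup Qm) ∧
    -- the decompositions `π^± = 1 + χ^± + π'`
    (2 ≤ m → ∃ χp χm : SpOrthogonal.Sp m F → ℂ,
      SpOrthogonal.IsIrreducibleCharacter χp ∧ SpOrthogonal.IsIrreducibleCharacter χm ∧
      χp ≠ 1 ∧ χm ≠ 1 ∧ χp ≠ χm ∧ (χm 1).re < (χp 1).re ∧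
      SpOrthogonal.permChar (SpOrthogonal.Sp m F) (ℙ F (SpOrthogonal.V m F)) = 1 + χp + χm ∧
      ∀ (v : SpOrthogonal.V m F) (hv : v ≠ 0),
        (∃ S : Finset (SpOrthogonal.parabolic v hv →* ℂˣ),
          SpOrthogonal.IsConjRepresentatives S) ∧
        ∀ S : Finset (SpOrthogonal.parabolic v hv →* ℂˣ),
          SpOrthogonal.IsConjRepresentatives S →
          S.card = Fintype.card F / 2 - 1 ∧
          (∀ ζ ∈ S, (SpOrthogonal.inducedRep ζ).IsIrreducible) ∧
          Set.InjOn (fun ζ : SpOrthogonal.parabolic v hv →* ℂˣ =>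
            (SpOrthogonal.inducedRep ζ).character) (S : Set _) ∧
          SpOrthogonal.permChar (SpOrthogonal.Sp m F)
              (SpOrthogonal.Sp m F ⧸ SpOrthogonal.orthogonalSubgroup Qp) =
            1 + χp + ∑ ζ ∈ S, (SpOrthogonal.inducedRep ζ).character ∧
          SpOrthogonal.permChar (SpOrthogonal.Sp m F)
              (SpOrthogonal.Sp m F ⧸ SpOrthogonal.orthogonalSubgroup Qm) =
            1 + χm + ∑ ζ ∈ S, (SpOrthogonal.inducedRep ζ).character) := by
  classical
  lift Qp to SpOrthogonal.Forms m F using hQp.polar_eq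
  lift Qm to SpOrthogonal.Forms m F using hQm.polar_eq
  have horb := SpOrthogonal.Forms.notMem_orbit_of_isPlusType_of_isMinusType hQp hQm
  refine ⟨SpOrthogonal.nonempty_vectors_equiv_cosets horb,
    SpOrthogonal.permChar_vectors_eq_add horb, fun hm2 ↦ ?_⟩
  obtain ⟨χp, χm, hirrp, hirrm, hp1, hm1, hpm, hpoints, hdec⟩ :=
    SpOrthogonal.exists_decomposition hm2 hQp hQm
  obtain ⟨T, hT⟩ := SpOrthogonal.exists_isInvTransversal (A := Fˣ →* ℂˣ) fun _ ↦
    SpOrthogonal.eq_one_of_character_eq_inv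
  refine ⟨χp, χm, hirrp, hirrm, hp1, hm1, hpm,
    SpOrthogonal.re_one_lt_of_permChar_eq hQp hQm (hdec T hT).1 (hdec T hT).2, hpoints,
    fun v hv ↦ ⟨SpOrthogonal.exists_isConjRepresentatives v hv, fun S hS ↦ ⟨hS.card_eq,
      hS.isIrreducible_inducedRep hm2, hS.injOn_character_inducedRep hm2, ?_⟩⟩⟩
  obtain ⟨T, hT, rfl⟩ := hS.exists_map_inflation_eq
  simpa only [Finset.sum_map, SpOrthogonal.character_inducedRep_inflation] using hdec T hT
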